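/- Let $(\mathbf X,V,S,Y)$ be random variables on a probability space, with $\mathbf X$ in a (nonempty) standard Borel space $\mathcal X$ (for instance $\mathbb R^d$), $V$ in a standard Borel space $\mathcal V$ with law $\nu$ (for instance $V\sim\mathrm{Unif}[0,1]$), $S\in[K]$ with $w_s:=\mathbb P(S=s)>0$ for every $s\in[K]$, and $Y$ real and integrable. Assume that $V$ and $S$ are independent and that $V=\psi(\mathbf X,S)$ a.s. for a measurable map $\psi$. Let $\mathcal F$ be the set of measurable functions $f:\mathcal X\times[K]\to\mathbb R$, let $f^*\in\mathcal F$ be a version of $f^*(\mathbf X,S)=\mathbb E[Y\mid\mathbf X,S]$, and for $f\in\mathcal F$ put $\mu_{f|v,s}:=\mathrm{Law}(f(\mathbf X,S)\mid V=v,S=s)$, $$\mathcal R(f):=\int_{\mathcal V}\sum_{s=1}^K w_s\,\mathbb E\big[(f(\mathbf X,S)-f^*(\mathbf X,S))^2\mid V=v,S=s\big]\,d\nu(v),\qquad \mathcal U(f):=\int_{\mathcal V}\min_{\mu\in\mathcal P_2(\mathbb R)}\sum_{s=1}^K w_s\,\mathcal W_2^2(\mu_{f|v,s},\mu)\,d\nu(v),$$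 both with values in $[0,\infty]$, where $\mathcal P_2(\mathbb R)$ is the set of probability measures on $\mathbb R$ with finite second moment and $\mathcal W_2$ is the Wasserstein-2 distance. A predictor $f\in\mathcal F$ is counterfactually fair (CF) if for almost every $(\mathbf x,s)$ under the law of $(\mathbf X,S)$ and every $s'\in[K]$ one has $\mathrm{Law}(\hat Y_{S\leftarrow s}\mid \mathbf X=\mathbf x,S=s)=\mathrm{Law}(\hat Y_{S\leftarrow s'}\mid \mathbf X=\mathbf x,S=s)$, where, given $\mathbf X=\mathbf x$ and $S=s$, the re-sampled counterfactual is $\hat Y_{S\leftarrow s'}:=f(\mathbf X',s')$ with $\mathbf X'\sim\mathrm{Law}(\mathbf X\mid V=\psi(\mathbf x,s),S=s')$. Assume that there is $M>0$ such that for $\nu$-almost every $v$ and all $s\in[K]$ the law $\mu_{f^*|v,s}$ is non-atomic and supported in $[-M,M]$, and let $\alpha\in[0,1]$. Then $\mathcal U(f^*)<\infty$, the problem of minimizing $\mathcal R(f)$ over the CF predictors $f\in\mathcal F$ has a solution, and every solution $f_0^*$ of it has $\mathcal R(f_0^*)<\infty$ and the following properties. The relaxed problem $$\min_{f\in\mathcal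 F}\{\mathcal R(f):\ \mathcal U(f)\le\alpha\,\mathcal U(f^*)\}$$ has the solution $$f_\alpha^*=\sqrt\alpha\,f^*+(1-\sqrt\alpha)\,f_0^*,$$ which is unique up to almost sure equality under the law of $(\mathbf X,S)$, and $$\mathcal R(f_\alpha^*)=(1-\sqrt\alpha)^2\,\mathcal R(f_0^*),\qquad \mathcal U(f_\alpha^*)=\alpha\,\mathcal U(f^*).$$ -/

import Mathlib

open MeasureTheory ProbabilityTheory
open scoped ENNReal

namespace CounterfactualFairness

noncomputable section

/-- The set `𝒫₂(ℝ)` of probability measures on `ℝ` with finite second moment. -/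
def P2 : Set (Measure ℝ) :=
  {μ | IsProbabilityMeasure μ ∧ MemLp (fun x : ℝ => x) 2 μ}

/-- The couplings of `μ` and `η`: measures on `ℝ × ℝ` with marginals `μ` and `η`. -/
def couplings (μ η : Measure ℝ) : Set (Measure (ℝ × ℝ)) :=
  {γ | γ.map Prod.fst = μ ∧ γ.map Prod.snd = η}

/-- The squared Wasserstein-2 distance, with values in `[0, ∞]`. -/
def W2sq (μ η : Measure ℝ) : ℝ≥0∞ :=
  ⨅ γ ∈ couplings μ η, ∫⁻ z, ENNReal.ofReal (|z.1 - z.2| ^ 2) ∂γ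

section Model

variable {Ω 𝒳 𝒱 : Type*} [MeasurableSpace Ω]
  [MeasurableSpace 𝒳] [StandardBorelSpace 𝒳] [Nonempty 𝒳]
  [MeasurableSpace 𝒱] {K : ℕ}

/-- The group weight `w_s = ℙ(S = s)`. -/
def weight (P : Measure Ω) (S : Ω → Fin K) (s : Fin K) : ℝ≥0∞ :=
  P (S ⁻¹' {s})

/-- The regular conditional distribution `Law(X ∣ V = v, S = s)`, as a kernel in `(v, s)`. -/
def featureLaw (P : Measure Ω) [IsFiniteMeasure P] (X : Ω → 𝒳) (V : Ω → 𝒱) (S : Ω → Fin K) :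
    Kernel (𝒱 × Fin K) 𝒳 :=
  condDistrib X (fun ω => (V ω, S ω)) P

/-- `μ_{f ∣ v, s} = Law(f(X, S) ∣ V = v, S = s)`. -/
def predLaw (P : Measure Ω) [IsFiniteMeasure P] (X : Ω → 𝒳) (V : Ω → 𝒱) (S : Ω → Fin K)
    (f : 𝒳 × Fin K → ℝ) (v : 𝒱) (s : Fin K) : Measure ℝ :=
  (featureLaw P X V S (v, s)).map (fun x => f (x, s))

/-- `f` is a (measurable version of the) Bayes predictor: `f(X, S) = 𝔼[Y ∣ X, S]` almost surely. -/
def IsBayesPredictor (P : Measure Ω) (X : Ω → 𝒳) (S : Ω → Fin K) (Y : Ω → ℝ)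
    (f : 𝒳 × Fin K → ℝ) : Prop :=
  Measurable f ∧
    (fun ω => f (X ω, S ω)) =ᵐ[P]
      P[Y | MeasurableSpace.comap (fun ω => (X ω, S ω)) inferInstance]

/-- Continuous predictions with bounded support: for some `M > 0`, the conditional laws
`μ_{f ∣ v, s}` are non-atomic and supported in `[-M, M]`. Conditional laws given `V = v` being
determined only up to null sets of `v`, this is required for almost every `v`. -/
def HasContinuousBoundedPredictions (P : Measure Ω) [IsFiniteMeasure P] (X : Ω → 𝒳) (V : Ω → 𝒱)
    (S : Ω → Fin K) (f : 𝒳 × Fin K → ℝ) : Prop :=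
  ∃ M : ℝ, 0 < M ∧ ∀ᵐ v ∂(P.map V), ∀ s : Fin K,
    (∀ t : ℝ, predLaw P X V S f v s {t} = 0) ∧
      predLaw P X V S f v s (Set.Icc (-M) M)ᶜ = 0

/-- The law of the re-sampled counterfactual `Ŷ_{S ← s'}` given `X = x, S = s`: recover
`v = ψ(x, s)`, draw `X' ∼ Law(X ∣ V = v, S = s')`, and output `f(X', s')`. -/
def counterfactualLaw (P : Measure Ω) [IsFiniteMeasure P] (X : Ω → 𝒳) (V : Ω → 𝒱)
    (S : Ω → Fin K) (ψ : 𝒳 × Fin K → 𝒱) (f : 𝒳 × Fin K → ℝ)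
    (x : 𝒳) (s s' : Fin K) : Measure ℝ :=
  (featureLaw P X V S (ψ (x, s), s')).map (fun x' => f (x', s'))

/-- Counterfactual fairness of the predictor `f(X, S)`: for almost every observed `(x, s)` and
every `s'`, the laws of `Ŷ_{S ← s}` and of `Ŷ_{S ← s'}` given `X = x, S = s` coincide. -/
def IsCF (P : Measure Ω) [IsFiniteMeasure P] (X : Ω → 𝒳) (V : Ω → 𝒱)
    (S : Ω → Fin K) (ψ : 𝒳 × Fin K → 𝒱) (f : 𝒳 × Fin K → ℝ) : Prop :=
  ∀ᵐ p ∂(P.map (fun ω => (X ω, S ω))), ∀ s' : Fin K,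
    counterfactualLaw P X V S ψ f p.1 p.2 p.2 = counterfactualLaw P X V S ψ f p.1 p.2 s'

/-- The conditional excess risk
`ℛ_v(f) = ∑ s, w_s 𝔼[(f(X, S) - f*(X, S))² ∣ V = v, S = s]`, with values in `[0, ∞]`. -/
def condRisk (P : Measure Ω) [IsFiniteMeasure P] (X : Ω → 𝒳) (V : Ω → 𝒱)
    (S : Ω → Fin K) (fstar f : 𝒳 × Fin K → ℝ) (v : 𝒱) : ℝ≥0∞ :=
  ∑ s : Fin K, weight P S s *
    ∫⁻ x, ENNReal.ofReal ((f (x, s) - fstar (x, s)) ^ 2) ∂(featureLaw P X V S (v, s))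

/-- The excess risk `ℛ(f) = ∫ ℛ_v(f) dν(v)`, where `ν` is the law of `V`. -/
def risk (P : Measure Ω) [IsFiniteMeasure P] (X : Ω → 𝒳) (V : Ω → 𝒱)
    (S : Ω → Fin K) (fstar f : 𝒳 × Fin K → ℝ) : ℝ≥0∞ :=
  ∫⁻ v, condRisk P X V S fstar f v ∂(P.map V)

/-- The unfairness at `V = v`,
`𝒰_v(f) = min_{μ ∈ 𝒫₂(ℝ)} ∑ s, w_s W₂²(μ_{f ∣ v, s}, μ)`, with values in `[0, ∞]`. -/
def condUnfairness (P : Measure Ω) [IsFiniteMeasure P] (X : Ω → 𝒳) (V : Ω → 𝒱)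
    (S : Ω → Fin K) (f : 𝒳 × Fin K → ℝ) (v : 𝒱) : ℝ≥0∞ :=
  ⨅ μ ∈ P2, ∑ s : Fin K, weight P S s * W2sq (predLaw P X V S f v s) μ

/-- The unfairness `𝒰(f) = ∫ 𝒰_v(f) dν(v)`, where `ν` is the law of `V`. -/
def unfairness (P : Measure Ω) [IsFiniteMeasure P] (X : Ω → 𝒳) (V : Ω → 𝒱)
    (S : Ω → Fin K) (f : 𝒳 × Fin K → ℝ) : ℝ≥0∞ :=
  ∫⁻ v, condUnfairness P X V S f v ∂(P.map V)

/-- `f` minimises the risk among the (measurable) counterfactually fair predictors. -/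
def IsFairOptimal (P : Measure Ω) [IsFiniteMeasure P] (X : Ω → 𝒳) (V : Ω → 𝒱)
    (S : Ω → Fin K) (ψ : 𝒳 × Fin K → 𝒱) (fstar f : 𝒳 × Fin K → ℝ) : Prop :=
  (Measurable f ∧ IsCF P X V S ψ f) ∧
    ∀ g : 𝒳 × Fin K → ℝ, Measurable g → IsCF P X V S ψ g →
      risk P X V S fstar f ≤ risk P X V S fstar g

/-- `f` minimises the risk among the (measurable) predictors `g` with `𝒰(g) ≤ α 𝒰(f*)`. -/
def IsRelaxedOptimal (P : Measure Ω) [IsFiniteMeasure P] (X : Ω → 𝒳) (V : Ω → 𝒱)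
    (S : Ω → Fin K) (fstar : 𝒳 × Fin K → ℝ) (α : ℝ) (f : 𝒳 × Fin K → ℝ) : Prop :=
  (Measurable f ∧ unfairness P X V S f ≤ ENNReal.ofReal α * unfairness P X V S fstar) ∧
    ∀ g : 𝒳 × Fin K → ℝ, Measurable g →
      unfairness P X V S g ≤ ENNReal.ofReal α * unfairness P X V S fstar →
      risk P X V S fstar f ≤ risk P X V S fstar g

/-- The predictor `√α f* + (1 - √α) f₀`. -/
def relaxedPredictor (α : ℝ) (fstar f0 : 𝒳 × Fin K → ℝ) : 𝒳 × Fin K → ℝ :=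
  fun p => √α * fstar p + (1 - √α) * f0 p

end Model

end

end CounterfactualFairness

open CounterfactualFairness

namespace CounterfactualFairness

section Lemmas

open Set Filter Topology

set_option linter.unusedSectionVars false

/-! On the line, optimal quadratic transport matches quantiles, so the problem becomes geometry in a
Hilbert space. Let q_s(v,u) be the conditional quantile functions of `fstar` and m = ∑ w_s q_s. In
the w-weighted L² space over ν ⊗ Unif(0,1), m is the orthogonal projection of q onto the families
that do not depend on s, and `dispersion` is the squared distance D from q to that subspace.
Replacing predictors by their quantile families can only lower the two functionals:
`lintegral_wSq_condQuantile_le_risk` for the risk, `dispersion_le_unfairness` for the unfairness.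

For `fstar` nothing is lost. Its conditional laws have no atoms, so its distribution function sends
it to a uniform variable, and `fairPredictor` evaluates m there, with v recovered by ψ. It is CF, it
is optimally coupled to `fstar`, and its risk is D (`map_prodMk_fairPredictor`,
`risk_fairPredictor`). Interpolating between the two predictors scales risk and unfairness as
claimed.

A family within (1 - √α)√D of q and within √α√D of the subspace must be the point of the segment [q,
m] (`ae_eq_interpolation`, from `wSq_identity`). A predictor that does as well as the interpolated
one must also be optimally coupled to `fstar`; the optimal coupling is unique
(`eq_comonotone_of_cost_le`) and is carried by a graph over `fstar`, so the predictor is determined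
almost surely (`ae_eq_relaxedPredictor`). Minimality follows from this uniqueness, and the CF
problem is the case α = 0, because CF predictors have dispersion zero. -/

/-! ### Quantile functions. -/

/-- The uniform distribution on `(0, 1)`, as a measure on `ℝ`. -/
noncomputable def unitUniform : Measure ℝ := volume.restrict (Ioo 0 1)

instance : IsProbabilityMeasure unitUniform := by
  constructor
  simp [unitUniform]

open Classical in
/-- The quantile function of `μ` on `(0, 1)`, extended by `0`. -/
noncomputable def quantile (μ : Measure ℝ) (u : ℝ) : ℝ :=
  if u ∈ Ioo (0 : ℝ) 1 then sInf {t | u ≤ cdf μ t} else 0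

lemma ae_unitUniform_mem : ∀ᵐ u ∂unitUniform, u ∈ Ioo (0 : ℝ) 1 :=
  ae_restrict_mem measurableSet_Ioo

/-- Right continuity of the distribution function makes the infimum attained. The later facts on
quantiles rest on this Galois connection. -/
lemma quantile_le_iff (μ : Measure ℝ) {u : ℝ} (hu : u ∈ Ioo (0 : ℝ) 1) (t : ℝ) :
    quantile μ u ≤ t ↔ u ≤ cdf μ t := by
  rw [quantile, if_pos hu]
  have hne : {t | u ≤ cdf μ t}.Nonempty :=
    ((tendsto_cdf_atTop μ).eventually_const_le hu.2).exists
  have hbdd : BddBelow {t | u ≤ cdf μ t} := by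
    obtain ⟨c, hc⟩ := ((tendsto_cdf_atBot μ).eventually_lt_const hu.1).exists
    refine ⟨c, fun x hx => ?_⟩
    by_contra h
    exact absurd (hx.trans (monotone_cdf μ (not_le.1 h).le)) (not_le.2 hc)
  refine ⟨fun h => ?_, fun h => csInf_le hbdd h⟩
  have hr : Tendsto (cdf μ) (𝓝[>] t) (𝓝 (cdf μ t)) :=
    ((cdf μ).right_continuous t).mono_left (nhdsWithin_mono _ Ioi_subset_Ici_self)
  refine ge_of_tendsto hr ?_
  filter_upwards [self_mem_nhdsWithin] with t' ht'
  obtain ⟨x, hx, hxt⟩ := exists_lt_of_csInf_lt hne (h.trans_lt ht')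
  exact le_trans hx (monotone_cdf μ hxt.le)

lemma lt_quantile_iff (μ : Measure ℝ) {u : ℝ} (hu : u ∈ Ioo (0 : ℝ) 1) (t : ℝ) :
    t < quantile μ u ↔ cdf μ t < u := by
  rw [← not_le, quantile_le_iff μ hu, not_le]

/-- Joint measurability in the parameter and the level, needed for Tonelli over (v, u). By the
Galois connection a sublevel set is a comparison of u with a distribution function; the second piece
is the default value 0 outside (0, 1). -/
lemma measurable_quantile_comp {Z : Type*} [MeasurableSpace Z] (ρ : Kernel Z ℝ)
    [IsMarkovKernel ρ] : Measurable fun p : Z × ℝ => quantile (ρ p.1) p.2 := by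
  have hF : ∀ t : ℝ, Measurable fun p : Z × ℝ => cdf (ρ p.1) t := fun t => by
    simp_rw [cdf_eq_real, measureReal_def]
    exact ((ρ.measurable_coe measurableSet_Iic).comp measurable_fst).ennreal_toReal
  refine measurable_of_Iic fun t => ?_
  have hS : MeasurableSet {p : Z × ℝ | p.2 ∈ Ioo (0 : ℝ) 1} := measurable_snd measurableSet_Ioo
  have : (fun p : Z × ℝ => quantile (ρ p.1) p.2) ⁻¹' Iic t
      = ({p | p.2 ∈ Ioo (0 : ℝ) 1} ∩ {p | p.2 ≤ cdf (ρ p.1) t})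
        ∪ ({p | p.2 ∈ Ioo (0 : ℝ) 1}ᶜ ∩ {_p | 0 ≤ t}) := by
    ext p
    by_cases hp : p.2 ∈ Ioo (0 : ℝ) 1
    · simp only [mem_preimage, mem_Iic, quantile_le_iff _ hp, mem_union, mem_inter_iff,
        mem_ofPred_eq, hp, mem_compl_iff, not_true, true_and, false_and, or_false]
    · simp only [mem_preimage, mem_Iic, quantile, mem_union, mem_inter_iff,
        mem_ofPred_eq, hp, if_false, mem_compl_iff, not_false_eq_true, true_and, false_and, false_or]
  rw [this]
  exact (hS.inter (measurableSet_le measurable_snd (hF t))).union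
    (hS.compl.inter (MeasurableSet.const _))

lemma measurable_quantile (μ : Measure ℝ) [IsProbabilityMeasure μ] : Measurable (quantile μ) :=
  (measurable_quantile_comp (Kernel.const Unit μ)).comp
    (measurable_const (a := ()) |>.prodMk measurable_id)

lemma measurable_cdf_comp {Z : Type*} [MeasurableSpace Z] (ρ : Kernel Z ℝ) [IsMarkovKernel ρ] :
    Measurable fun p : Z × ℝ => cdf (ρ p.1) p.2 := by
  simp_rw [cdf_eq_real, measureReal_def]
  have h : MeasurableSet {x : (Z × ℝ) × ℝ | x.2 ≤ x.1.2} :=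
    measurableSet_le measurable_snd (measurable_snd.comp measurable_fst)
  exact (Kernel.measurable_kernel_prodMk_left
    (κ := ρ.comap (Prod.fst : Z × ℝ → Z) measurable_fst) h).ennreal_toReal

lemma unitUniform_Ioc {a b : ℝ} (ha : 0 ≤ a) (hb : b ≤ 1) :
    unitUniform (Ioc a b) = ENNReal.ofReal (b - a) := by
  rw [unitUniform, ← Measure.restrict_congr_set (Ioo_ae_eq_Ioc.symm : Ioc (0 : ℝ) 1 =ᵐ[volume] _),
    Measure.restrict_apply measurableSet_Ioc, inter_eq_left.2 (Ioc_subset_Ioc ha hb),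
    Real.volume_Ioc]

/-- Inverse transform sampling: up to a null set, the quantile is at most t exactly on (0, F(t)]. -/
lemma map_quantile (μ : Measure ℝ) [IsProbabilityMeasure μ] :
    unitUniform.map (quantile μ) = μ := by
  have := Measure.isProbabilityMeasure_map (μ := unitUniform) (measurable_quantile μ).aemeasurable
  refine Measure.ext_of_Iic _ _ fun t => ?_
  rw [Measure.map_apply (measurable_quantile μ) measurableSet_Iic, ← ofReal_cdf μ,
    ← sub_zero (cdf μ t), ← unitUniform_Ioc le_rfl (cdf_le_one μ t)]
  refine measure_congr (eventuallyEq_set.2 ?_)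
  filter_upwards [ae_unitUniform_mem] with u hu
  exact (quantile_le_iff μ hu t).trans ⟨fun h => ⟨hu.1, h⟩, fun h => h.2⟩

/-! ### The comonotone coupling and its optimality. -/

/-- The comonotone coupling of `μ` and `η`. -/
noncomputable def comonotone (μ η : Measure ℝ) : Measure (ℝ × ℝ) :=
  unitUniform.map fun u => (quantile μ u, quantile η u)

lemma measurable_quantile_prodMk (μ η : Measure ℝ) [IsProbabilityMeasure μ]
    [IsProbabilityMeasure η] : Measurable fun u => (quantile μ u, quantile η u) :=
  (measurable_quantile μ).prodMk (measurable_quantile η)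

lemma measurableSet_fst_le_lt_snd (s t : ℝ) :
    MeasurableSet {z : ℝ × ℝ | z.1 ≤ s ∧ t < z.2} :=
  (measurableSet_le measurable_fst measurable_const).inter
    (measurableSet_lt measurable_const measurable_snd)

lemma measurableSet_snd_le_lt_fst (s t : ℝ) :
    MeasurableSet {z : ℝ × ℝ | z.2 ≤ s ∧ t < z.1} :=
  (measurableSet_le measurable_snd measurable_const).inter
    (measurableSet_lt measurable_const measurable_fst)

/-- The event is that u lies in the interval (F_η(t), F_μ(s)]. The truncated subtraction accounts
for the empty interval. -/
lemma comonotone_apply (μ η : Measure ℝ) [IsProbabilityMeasure μ] [IsProbabilityMeasure η]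
    (s t : ℝ) : comonotone μ η {z | z.1 ≤ s ∧ t < z.2} = μ (Iic s) - η (Iic t) := by
  rw [comonotone, Measure.map_apply (measurable_quantile_prodMk μ η)
    (measurableSet_fst_le_lt_snd s t), ← ofReal_cdf μ, ← ofReal_cdf η,
    ← ENNReal.ofReal_sub _ (cdf_nonneg η t),
    ← unitUniform_Ioc (cdf_nonneg η t) (cdf_le_one μ s)]
  refine measure_congr (eventuallyEq_set.2 ?_)
  filter_upwards [ae_unitUniform_mem] with u hu
  rw [mem_preimage, mem_ofPred_eq, quantile_le_iff μ hu, lt_quantile_iff η hu, mem_Ioc, and_comm]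

lemma comonotone_apply' (μ η : Measure ℝ) [IsProbabilityMeasure μ] [IsProbabilityMeasure η]
    (s t : ℝ) : comonotone μ η {z | z.2 ≤ s ∧ t < z.1} = η (Iic s) - μ (Iic t) := by
  rw [comonotone, Measure.map_apply (measurable_quantile_prodMk μ η)
    (measurableSet_snd_le_lt_fst s t), ← ofReal_cdf η, ← ofReal_cdf μ,
    ← ENNReal.ofReal_sub _ (cdf_nonneg μ t),
    ← unitUniform_Ioc (cdf_nonneg μ t) (cdf_le_one η s)]
  refine measure_congr (eventuallyEq_set.2 ?_)
  filter_upwards [ae_unitUniform_mem] with u hu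
  rw [mem_preimage, mem_ofPred_eq, quantile_le_iff η hu, lt_quantile_iff μ hu, mem_Ioc, and_comm]

lemma comonotone_mem_couplings (μ η : Measure ℝ) [IsProbabilityMeasure μ]
    [IsProbabilityMeasure η] : comonotone μ η ∈ couplings μ η := by
  have h := measurable_quantile_prodMk μ η
  constructor
  · rw [comonotone, Measure.map_map measurable_fst h]
    exact map_quantile μ
  · rw [comonotone, Measure.map_map measurable_snd h]
    exact map_quantile η

/-- The quadratic cost of a measure on `ℝ × ℝ` as an integral of orthant masses. -/
lemma lintegral_sq_eq (γ : Measure (ℝ × ℝ)) [SFinite γ] :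
    ∫⁻ z, ENNReal.ofReal (|z.1 - z.2| ^ 2) ∂γ =
      ∫⁻ p : ℝ × ℝ, (γ {z | z.1 ≤ min p.1 p.2 ∧ max p.1 p.2 < z.2}
        + γ {z | z.2 ≤ min p.1 p.2 ∧ max p.1 p.2 < z.1}) := by
  have hmin : Measurable fun q : (ℝ × ℝ) × (ℝ × ℝ) => min q.2.1 q.2.2 := by fun_prop
  have hmax : Measurable fun q : (ℝ × ℝ) × (ℝ × ℝ) => max q.2.1 q.2.2 := by fun_prop
  have hA : MeasurableSet {q : (ℝ × ℝ) × (ℝ × ℝ) | q.1.1 ≤ min q.2.1 q.2.2 ∧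
      max q.2.1 q.2.2 < q.1.2} :=
    (measurableSet_le (by fun_prop) hmin).inter (measurableSet_lt hmax (by fun_prop))
  have hB : MeasurableSet {q : (ℝ × ℝ) × (ℝ × ℝ) | q.1.2 ≤ min q.2.1 q.2.2 ∧
      max q.2.1 q.2.2 < q.1.1} :=
    (measurableSet_le (by fun_prop) hmin).inter (measurableSet_lt hmax (by fun_prop))
  have hAm := measurable_measure_prodMk_right (μ := γ) hA
  -- The squared distance is the area of the square with side [x, y) or [y, x); Tonelli then
  -- exchanges this area with γ.
  have key : ∀ z : ℝ × ℝ, ENNReal.ofReal (|z.1 - z.2| ^ 2) =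
      volume (Prod.mk z ⁻¹' {q : (ℝ × ℝ) × (ℝ × ℝ) | q.1.1 ≤ min q.2.1 q.2.2 ∧
        max q.2.1 q.2.2 < q.1.2}) +
      volume (Prod.mk z ⁻¹' {q : (ℝ × ℝ) × (ℝ × ℝ) | q.1.2 ≤ min q.2.1 q.2.2 ∧
        max q.2.1 q.2.2 < q.1.1}) := by
    rintro ⟨x, y⟩
    have e : ∀ x y : ℝ, {p : ℝ × ℝ | x ≤ min p.1 p.2 ∧ max p.1 p.2 < y} = Ico x y ×ˢ Ico x y := by
      intro x y
      ext p
      simp only [mem_ofPred_eq, le_min_iff, max_lt_iff, mem_prod, mem_Ico]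
      tauto
    simp only [preimage_ofPred_eq, e, Measure.volume_eq_prod, Measure.prod_prod, Real.volume_Ico,
      sq_abs]
    rcases le_total x y with h | h
    · rw [ENNReal.ofReal_of_nonpos (sub_nonpos.2 h), zero_mul, add_zero,
        ← ENNReal.ofReal_mul (sub_nonneg.2 h)]
      ring_nf
    · rw [ENNReal.ofReal_of_nonpos (sub_nonpos.2 h), zero_mul, zero_add,
        ← ENNReal.ofReal_mul (sub_nonneg.2 h)]
      ring_nf
  simp_rw [key]
  rw [lintegral_add_left (measurable_measure_prodMk_left hA), ← Measure.prod_apply hA,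
    ← Measure.prod_apply hB, Measure.prod_apply_symm hA, Measure.prod_apply_symm hB,
    ← lintegral_add_left hAm]
  rfl

lemma isProbabilityMeasure_of_mem_couplings {μ η : Measure ℝ} [IsProbabilityMeasure μ]
    {γ : Measure (ℝ × ℝ)} (hγ : γ ∈ couplings μ η) : IsProbabilityMeasure γ := by
  have : IsProbabilityMeasure (γ.map Prod.fst) := by rw [hγ.1]; infer_instance
  exact Measure.isProbabilityMeasure_of_map Prod.fst

lemma measure_fst_le {μ η : Measure ℝ} {γ : Measure (ℝ × ℝ)} (hγ : γ ∈ couplings μ η) (s : ℝ) :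
    γ {z | z.1 ≤ s} = μ (Iic s) := by
  rw [← hγ.1, Measure.map_apply measurable_fst measurableSet_Iic]
  rfl

lemma measure_snd_le {μ η : Measure ℝ} {γ : Measure (ℝ × ℝ)} (hγ : γ ∈ couplings μ η) (s : ℝ) :
    γ {z | z.2 ≤ s} = η (Iic s) := by
  rw [← hγ.2, Measure.map_apply measurable_snd measurableSet_Iic]
  rfl

/-- A union bound valid for every coupling. The comonotone one attains it for all s and t at once,
hence is optimal. -/
lemma sub_le_measure {μ η : Measure ℝ} {γ : Measure (ℝ × ℝ)} (hγ : γ ∈ couplings μ η) (s t : ℝ) :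
    μ (Iic s) - η (Iic t) ≤ γ {z | z.1 ≤ s ∧ t < z.2} := by
  rw [tsub_le_iff_right, ← measure_fst_le hγ, ← measure_snd_le hγ]
  refine (measure_mono fun z hz => ?_).trans (measure_union_le _ _)
  rcases le_or_gt z.2 t with h | h
  · exact Or.inr h
  · exact Or.inl ⟨hz, h⟩

lemma sub_le_measure' {μ η : Measure ℝ} {γ : Measure (ℝ × ℝ)} (hγ : γ ∈ couplings μ η) (s t : ℝ) :
    η (Iic s) - μ (Iic t) ≤ γ {z | z.2 ≤ s ∧ t < z.1} := by
  rw [tsub_le_iff_right, ← measure_fst_le hγ, ← measure_snd_le hγ]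
  refine (measure_mono fun z hz => ?_).trans (measure_union_le _ _)
  rcases le_or_gt z.1 t with h | h
  · exact Or.inr h
  · exact Or.inl ⟨hz, h⟩

lemma lintegral_comonotone (μ η : Measure ℝ) [IsProbabilityMeasure μ] [IsProbabilityMeasure η] :
    ∫⁻ z, ENNReal.ofReal (|z.1 - z.2| ^ 2) ∂(comonotone μ η) =
      ∫⁻ u, ENNReal.ofReal ((quantile μ u - quantile η u) ^ 2) ∂unitUniform := by
  rw [comonotone, lintegral_map (by fun_prop) (measurable_quantile_prodMk μ η)]
  simp only [sq_abs]

lemma comonotone_cost_le {μ η : Measure ℝ} [IsProbabilityMeasure μ] [IsProbabilityMeasure η]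
    {γ : Measure (ℝ × ℝ)} (hγ : γ ∈ couplings μ η) :
    ∫⁻ u, ENNReal.ofReal ((quantile μ u - quantile η u) ^ 2) ∂unitUniform ≤
      ∫⁻ z, ENNReal.ofReal (|z.1 - z.2| ^ 2) ∂γ := by
  have := isProbabilityMeasure_of_mem_couplings hγ
  have := isProbabilityMeasure_of_mem_couplings (comonotone_mem_couplings μ η)
  rw [← lintegral_comonotone, lintegral_sq_eq, lintegral_sq_eq]
  refine lintegral_mono fun p => ?_
  rw [comonotone_apply, comonotone_apply']
  exact add_le_add (sub_le_measure hγ _ _) (sub_le_measure' hγ _ _)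

lemma comonotone_cost_le_W2sq (μ η : Measure ℝ) [IsProbabilityMeasure μ]
    [IsProbabilityMeasure η] :
    ∫⁻ u, ENNReal.ofReal ((quantile μ u - quantile η u) ^ 2) ∂unitUniform ≤ W2sq μ η :=
  le_iInf₂ fun _ hγ => comonotone_cost_le hγ

/-! ### Uniqueness of the optimal coupling. -/

/-- Finite measures on `ℝ` agreeing on almost every half-line are equal. -/
lemma measure_ext_of_ae_Iic {μ η : Measure ℝ} [IsFiniteMeasure μ] [IsFiniteMeasure η]
    (h : ∀ᵐ t, μ (Iic t) = η (Iic t)) : μ = η := by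
  have hT : ∀ (m : Measure ℝ) [IsFiniteMeasure m] (t : ℝ),
      Tendsto (fun r => m (Iic r)) (𝓝[>] t) (𝓝 (m (Iic t))) := by
    intro m _ t
    have := tendsto_measure_biInter_gt (μ := m) (s := fun r => Iic r) (a := t)
      (fun r _ => measurableSet_Iic.nullMeasurableSet) (fun i j _ hij => Iic_subset_Iic.2 hij)
      ⟨t + 1, by simp, measure_ne_top _ _⟩
    have e : ⋂ r > t, Iic r = Iic t := by
      ext x
      simp only [mem_iInter, mem_Iic]
      exact ⟨fun hx => le_of_forall_gt_imp_ge_of_dense hx, fun hx r hr => hx.trans hr.le⟩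
    rw [e] at this
    exact this
  refine Measure.ext_of_Iic _ _ fun t => ?_
  refine tendsto_nhds_unique_of_frequently_eq (hT μ t) (hT η t) ?_
  rw [Filter.Frequently, nhdsWithin]
  intro hc
  rw [eventually_inf_principal] at hc
  obtain ⟨ε, hε, hb⟩ := Metric.eventually_nhds_iff.1 hc
  -- If the half-line masses differed on all of (t, t + ε), this interval would lie in the
  -- exceptional null set.
  have h0 : volume (Ioo t (t + ε)) = 0 := by
    refine measure_mono_null (fun r hr => ?_) h
    refine hb ?_ hr.1
    rw [Real.dist_eq, abs_of_pos (sub_pos.2 hr.1)]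
    linarith [hr.2]
  rw [Real.volume_Ioo] at h0
  simp at h0
  linarith

/-- The one-dimensional statement is applied twice: first in t for almost every s, then in s with an
arbitrary measurable second side. -/
lemma measure_prod_ext_of_ae_Iic {γ γ' : Measure (ℝ × ℝ)} [IsFiniteMeasure γ] [IsFiniteMeasure γ']
    (h : ∀ᵐ p : ℝ × ℝ, γ (Iic p.1 ×ˢ Iic p.2) = γ' (Iic p.1 ×ˢ Iic p.2)) : γ = γ' := by
  have h1 : ∀ᵐ s : ℝ, (γ.restrict (Iic s ×ˢ univ)).map Prod.snd
      = (γ'.restrict (Iic s ×ˢ univ)).map Prod.snd := by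
    filter_upwards [Measure.ae_ae_of_ae_prod h] with s hs
    refine measure_ext_of_ae_Iic ?_
    filter_upwards [hs] with t ht
    have e : (Prod.snd ⁻¹' Iic t : Set (ℝ × ℝ)) ∩ Iic s ×ˢ univ = Iic s ×ˢ Iic t := by
      ext z
      simp only [mem_inter_iff, mem_preimage, mem_prod, mem_univ, and_true]
      exact and_comm
    rw [Measure.map_apply measurable_snd measurableSet_Iic,
      Measure.map_apply measurable_snd measurableSet_Iic,
      Measure.restrict_apply (measurable_snd measurableSet_Iic),
      Measure.restrict_apply (measurable_snd measurableSet_Iic), e, ht]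
  have h2 : ∀ B : Set ℝ, MeasurableSet B → (γ.restrict (univ ×ˢ B)).map Prod.fst
      = (γ'.restrict (univ ×ˢ B)).map Prod.fst := by
    intro B hB
    refine measure_ext_of_ae_Iic ?_
    filter_upwards [h1] with s hs
    have e : (Prod.fst ⁻¹' Iic s : Set (ℝ × ℝ)) ∩ univ ×ˢ B = Prod.snd ⁻¹' B ∩ Iic s ×ˢ univ := by
      ext z; simp [and_comm]
    have hs' := congrArg (fun m => m B) hs
    simp only [Measure.map_apply measurable_snd hB,
      Measure.restrict_apply (measurable_snd hB)] at hs'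
    rw [Measure.map_apply measurable_fst measurableSet_Iic,
      Measure.map_apply measurable_fst measurableSet_Iic,
      Measure.restrict_apply (measurable_fst measurableSet_Iic),
      Measure.restrict_apply (measurable_fst measurableSet_Iic), e, hs']
  refine Measure.ext_prod fun {A B} hA hB => ?_
  have h3 := congrArg (fun m => m A) (h2 B hB)
  simp only [Measure.map_apply measurable_fst hA, Measure.restrict_apply (measurable_fst hA)] at h3
  have e : (Prod.fst ⁻¹' A : Set (ℝ × ℝ)) ∩ univ ×ˢ B = A ×ˢ B := by
    ext z; simp
  rwa [e] at h3

/-- Recovers the joint distribution function from an orthant mass. This form serves corners with s ≤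
t, its mirror image those with t ≤ s. -/
lemma measure_Iic_prod_Iic {μ η : Measure ℝ} [IsProbabilityMeasure μ]
    {γ : Measure (ℝ × ℝ)} (hγ : γ ∈ couplings μ η) (s t : ℝ) :
    γ (Iic s ×ˢ Iic t) = μ (Iic s) - γ {z | z.1 ≤ s ∧ t < z.2} := by
  have := isProbabilityMeasure_of_mem_couplings hγ
  rw [← measure_fst_le hγ, ← measure_sdiff (s₁ := {z : ℝ × ℝ | z.1 ≤ s})
    (s₂ := {z : ℝ × ℝ | z.1 ≤ s ∧ t < z.2}) (fun z hz => hz.1) (measurableSet_fst_le_lt_snd s t).nullMeasurableSet (measure_ne_top _ _)]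
  congr 1
  ext z
  simp only [mem_prod, mem_Iic, Set.mem_sdiff, mem_ofPred_eq, not_and, not_lt]
  tauto

lemma measure_Iic_prod_Iic' {μ η : Measure ℝ} [IsProbabilityMeasure μ]
    {γ : Measure (ℝ × ℝ)} (hγ : γ ∈ couplings μ η) (s t : ℝ) :
    γ (Iic s ×ˢ Iic t) = η (Iic t) - γ {z | z.2 ≤ t ∧ s < z.1} := by
  have := isProbabilityMeasure_of_mem_couplings hγ
  rw [← measure_snd_le hγ, ← measure_sdiff (s₁ := {z : ℝ × ℝ | z.2 ≤ t})
    (s₂ := {z : ℝ × ℝ | z.2 ≤ t ∧ s < z.1}) (fun z hz => hz.1) (measurableSet_snd_le_lt_fst t s).nullMeasurableSet (measure_ne_top _ _)]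
  congr 1
  ext z
  simp only [mem_prod, mem_Iic, Set.mem_sdiff, mem_ofPred_eq, not_and, not_lt]
  tauto

lemma measurable_orthant_mass (γ : Measure (ℝ × ℝ)) [SFinite γ] :
    Measurable fun p : ℝ × ℝ => γ {z | z.1 ≤ min p.1 p.2 ∧ max p.1 p.2 < z.2}
        + γ {z | z.2 ≤ min p.1 p.2 ∧ max p.1 p.2 < z.1} := by
  have hmin : Measurable fun q : (ℝ × ℝ) × (ℝ × ℝ) => min q.1.1 q.1.2 := by fun_prop
  have hmax : Measurable fun q : (ℝ × ℝ) × (ℝ × ℝ) => max q.1.1 q.1.2 := by fun_prop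
  exact (measurable_measure_prodMk_left (ν := γ)
      ((measurableSet_le (by fun_prop : Measurable fun q : (ℝ × ℝ) × (ℝ × ℝ) => q.2.1) hmin).inter
        (measurableSet_lt hmax (by fun_prop : Measurable fun q : (ℝ × ℝ) × (ℝ × ℝ) => q.2.2)))).add
    (measurable_measure_prodMk_left (ν := γ)
      ((measurableSet_le (by fun_prop : Measurable fun q : (ℝ × ℝ) × (ℝ × ℝ) => q.2.2) hmin).inter
        (measurableSet_lt hmax (by fun_prop : Measurable fun q : (ℝ × ℝ) × (ℝ × ℝ) => q.2.1))))

/-- On the line the optimal coupling for the quadratic cost is unique. -/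
lemma eq_comonotone_of_cost_le {μ η : Measure ℝ} [IsProbabilityMeasure μ] [IsProbabilityMeasure η]
    {γ : Measure (ℝ × ℝ)} (hγ : γ ∈ couplings μ η)
    (hfin : ∫⁻ u, ENNReal.ofReal ((quantile μ u - quantile η u) ^ 2) ∂unitUniform ≠ ∞)
    (hle : ∫⁻ z, ENNReal.ofReal (|z.1 - z.2| ^ 2) ∂γ ≤
      ∫⁻ u, ENNReal.ofReal ((quantile μ u - quantile η u) ^ 2) ∂unitUniform) :
    γ = comonotone μ η := by
  have hc := comonotone_mem_couplings μ η
  have := isProbabilityMeasure_of_mem_couplings hγ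
  have := isProbabilityMeasure_of_mem_couplings hc
  rw [← lintegral_comonotone, lintegral_sq_eq] at hfin
  rw [← lintegral_comonotone, lintegral_sq_eq, lintegral_sq_eq] at hle
  -- The orthant masses are ordered pointwise, so equal finite integrals force equality at almost
  -- every corner.
  have hae := ae_eq_of_ae_le_of_lintegral_le (Eventually.of_forall fun p => by
    rw [comonotone_apply, comonotone_apply']
    exact add_le_add (sub_le_measure hγ _ _) (sub_le_measure' hγ _ _)) hfin
    (measurable_orthant_mass γ).aemeasurable hle
  refine measure_prod_ext_of_ae_Iic ?_
  filter_upwards [hae] with p hp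
  have h1 := sub_le_measure hγ (min p.1 p.2) (max p.1 p.2)
  have h2 := sub_le_measure' hγ (min p.1 p.2) (max p.1 p.2)
  rw [← comonotone_apply] at h1
  rw [← comonotone_apply'] at h2
  -- Each of the two summands is minimal for the comonotone coupling, so equality of the sums
  -- separates.
  have e1 : comonotone μ η {z | z.1 ≤ min p.1 p.2 ∧ max p.1 p.2 < z.2}
      = γ {z | z.1 ≤ min p.1 p.2 ∧ max p.1 p.2 < z.2} := by
    refine h1.antisymm (ENNReal.le_of_add_le_add_right
      (measure_ne_top (comonotone μ η) {z | z.2 ≤ min p.1 p.2 ∧ max p.1 p.2 < z.1}) ?_)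
    rw [hp]
    gcongr
  have e2 : comonotone μ η {z | z.2 ≤ min p.1 p.2 ∧ max p.1 p.2 < z.1}
      = γ {z | z.2 ≤ min p.1 p.2 ∧ max p.1 p.2 < z.1} := by
    rw [e1] at hp
    exact (ENNReal.add_right_inj (measure_ne_top _ _)).1 hp
  rcases le_total p.1 p.2 with h | h
  · rw [min_eq_left h, max_eq_right h] at e1
    rw [measure_Iic_prod_Iic hγ, measure_Iic_prod_Iic hc, e1]
  · rw [min_eq_right h, max_eq_left h] at e2
    rw [measure_Iic_prod_Iic' hγ, measure_Iic_prod_Iic' hc, e2]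

/-- For a non-atomic law, the distribution function inverts the quantile function. -/
lemma cdf_quantile {μ : Measure ℝ} [IsProbabilityMeasure μ] (hμ : ∀ t, μ {t} = 0) {u : ℝ}
    (hu : u ∈ Ioo (0 : ℝ) 1) : cdf μ (quantile μ u) = u := by
  refine le_antisymm ?_ ((quantile_le_iff μ hu _).1 le_rfl)
  -- The jump of the distribution function at a point is the mass of that point, here zero.
  have hcont : ContinuousAt (cdf μ) (quantile μ u) := by
    rw [(monotone_cdf μ).continuousAt_iff_leftLim_eq_rightLim, (cdf μ).rightLim_eq]
    have h := (cdf μ).measure_singleton (quantile μ u)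
    rw [measure_cdf, hμ] at h
    have h' := (monotone_cdf μ).leftLim_le (le_refl (quantile μ u))
    have := ENNReal.ofReal_eq_zero.1 h.symm
    linarith
  have hl : Tendsto (cdf μ) (𝓝[<] (quantile μ u)) (𝓝 (cdf μ (quantile μ u))) :=
    hcont.mono_left nhdsWithin_le_nhds
  refine le_of_tendsto hl ?_
  filter_upwards [self_mem_nhdsWithin] with t ht
  exact ((lt_quantile_iff μ hu t).1 ht).le

/-! ### Projection onto constant families and interpolation. -/

section WeightedMean

variable {K : ℕ}

/-- The weighted mean of a finite family. -/
def wMean (w G : Fin K → ℝ) : ℝ := ∑ s, w s * G s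

/-- The weighted sum of squares of a finite family. -/
def wSq (w G : Fin K → ℝ) : ℝ := ∑ s, w s * G s ^ 2

lemma wSq_nonneg {w : Fin K → ℝ} (hw : ∀ s, 0 ≤ w s) (G : Fin K → ℝ) : 0 ≤ wSq w G :=
  Finset.sum_nonneg fun s _ => mul_nonneg (hw s) (sq_nonneg _)

lemma sum_mul_sub_wMean {w : Fin K → ℝ} (hw1 : ∑ s, w s = 1) (G : Fin K → ℝ) :
    ∑ s, w s * (G s - wMean w G) = 0 := by
  simp only [mul_sub, Finset.sum_sub_distrib, ← Finset.sum_mul, hw1, one_mul]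
  exact sub_self _

/-- Pythagoras: deviations from the mean are orthogonal to constants. -/
lemma wSq_sub_const {w : Fin K → ℝ} (hw1 : ∑ s, w s = 1) (G : Fin K → ℝ) (y : ℝ) :
    wSq w (fun s => G s - y) = wSq w (fun s => G s - wMean w G) + (wMean w G - y) ^ 2 := by
  have h0 := sum_mul_sub_wMean hw1 G
  have key : ∀ s, w s * (G s - y) ^ 2 = w s * (G s - wMean w G) ^ 2 +
      (2 * (wMean w G - y) * (w s * (G s - wMean w G)) + w s * (wMean w G - y) ^ 2) :=
    fun s => by ring
  simp only [wSq, key, Finset.sum_add_distrib, ← Finset.mul_sum, ← Finset.sum_mul, hw1, h0]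
  ring

/-- With x and y the centred parts of q and G, this is Stewart's identity ‖y - ax‖² + a(1-a)‖x‖² =
(1-a)‖y‖² + a‖x - y‖², plus the contribution of the means. Having no subtracted squares, it
integrates in [0, ∞] without finiteness assumptions. -/
lemma wSq_identity {w : Fin K → ℝ} (hw1 : ∑ s, w s = 1) (a : ℝ) (q G : Fin K → ℝ) :
    wSq w (fun s => (G s - wMean w G) - a * (q s - wMean w q)) + a * (wMean w q - wMean w G) ^ 2
      + a * (1 - a) * wSq w (fun s => q s - wMean w q)
    = (1 - a) * wSq w (fun s => G s - wMean w G) + a * wSq w (fun s => q s - G s) := by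
  have hq := sum_mul_sub_wMean hw1 q
  have hG := sum_mul_sub_wMean hw1 G
  have key : ∀ s, a * (w s * (q s - G s) ^ 2) =
      w s * ((G s - wMean w G) - a * (q s - wMean w q)) ^ 2 + w s *
        (a * (wMean w q - wMean w G) ^ 2) +
      a * (1 - a) * (w s * (q s - wMean w q) ^ 2) - (1 - a) * (w s * (G s - wMean w G) ^ 2) +
      (2 * a * (wMean w q - wMean w G)) * (w s * (q s - wMean w q)) -
      (2 * a * (wMean w q - wMean w G)) * (w s * (G s - wMean w G)) := fun s => by ring
  have h : a * wSq w (fun s => q s - G s) = wSq w (fun s => (G s - wMean w G) -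
      a * (q s - wMean w q)) + a * (wMean w q - wMean w G) ^ 2
      + a * (1 - a) * wSq w (fun s => q s - wMean w q)
      - (1 - a) * wSq w (fun s => G s - wMean w G) := by
    simp only [wSq, Finset.mul_sum _ _ a, key]
    simp only [Finset.sum_add_distrib, Finset.sum_sub_distrib, ← Finset.mul_sum, ← Finset.sum_mul,
      hw1, hq, hG]
    ring
  linarith

variable {Z : Type*} [MeasurableSpace Z]

lemma measurable_wMean (w : Fin K → ℝ) {G : Fin K → Z → ℝ} (hG : ∀ s, Measurable (G s)) :
    Measurable fun z => wMean w fun s => G s z :=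
  Finset.measurable_sum _ fun s _ => (hG s).const_mul _

lemma measurable_wSq (w : Fin K → ℝ) {G : Fin K → Z → ℝ} (hG : ∀ s, Measurable (G s)) :
    Measurable fun z => wSq w fun s => G s z :=
  Finset.measurable_sum _ fun s _ => ((hG s).pow_const 2).const_mul _

lemma lintegral_wSq_identity (m : Measure Z) {w : Fin K → ℝ} (hw : ∀ s, 0 ≤ w s)
    (hw1 : ∑ s, w s = 1) {a : ℝ} (ha : a ∈ Icc (0 : ℝ) 1) {q G : Fin K → Z → ℝ}
    (hq : ∀ s, Measurable (q s)) (hG : ∀ s, Measurable (G s)) :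
    (∫⁻ z, ENNReal.ofReal (wSq w fun s => (G s z - wMean w (G · z)) -
        a * (q s z - wMean w (q · z))) ∂m) +
      ENNReal.ofReal a * (∫⁻ z, ENNReal.ofReal ((wMean w (q · z) - wMean w (G · z)) ^ 2) ∂m) +
      ENNReal.ofReal (a * (1 - a)) *
        (∫⁻ z, ENNReal.ofReal (wSq w fun s => q s z - wMean w (q · z)) ∂m) =
    ENNReal.ofReal (1 - a) * (∫⁻ z, ENNReal.ofReal (wSq w fun s => G s z - wMean w (G · z)) ∂m) +
      ENNReal.ofReal a * (∫⁻ z, ENNReal.ofReal (wSq w fun s => q s z - G s z) ∂m) := by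
  have hmq := measurable_wMean w hq
  have hmG := measurable_wMean w hG
  have m1 : Measurable fun z => wSq w fun s => (G s z - wMean w (G · z)) -
      a * (q s z - wMean w (q · z)) :=
    measurable_wSq w fun s => ((hG s).sub hmG).sub (((hq s).sub hmq).const_mul a)
  have m2 : Measurable fun z => (wMean w (q · z) - wMean w (G · z)) ^ 2 :=
    (hmq.sub hmG).pow_const 2
  have m3 : Measurable fun z => wSq w fun s => q s z - wMean w (q · z) :=
    measurable_wSq w fun s => (hq s).sub hmq
  have m4 : Measurable fun z => wSq w fun s => G s z - wMean w (G · z) :=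
    measurable_wSq w fun s => (hG s).sub hmG
  have m5 : Measurable fun z => wSq w fun s => q s z - G s z :=
    measurable_wSq w fun s => (hq s).sub (hG s)
  rw [← lintegral_const_mul _ m2.ennreal_ofReal, ← lintegral_const_mul _ m3.ennreal_ofReal,
    ← lintegral_const_mul _ m4.ennreal_ofReal, ← lintegral_const_mul _ m5.ennreal_ofReal,
    ← lintegral_add_left m1.ennreal_ofReal,
    ← lintegral_add_right _ (m3.ennreal_ofReal.const_mul _),
    ← lintegral_add_left (m4.ennreal_ofReal.const_mul _)]
  have ha0 := ha.1
  have ha1 : 0 ≤ 1 - a := sub_nonneg.2 ha.2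
  refine lintegral_congr fun z => ?_
  have h1 := wSq_nonneg hw fun s => (G s z - wMean w (G · z)) - a * (q s z - wMean w (q · z))
  have h3 := wSq_nonneg hw fun s => q s z - wMean w (q · z)
  have h4 := wSq_nonneg hw fun s => G s z - wMean w (G · z)
  have h5 := wSq_nonneg hw fun s => q s z - G s z
  rw [← ENNReal.ofReal_mul ha0, ← ENNReal.ofReal_mul (mul_nonneg ha0 ha1),
    ← ENNReal.ofReal_mul ha1, ← ENNReal.ofReal_mul ha0,
    ← ENNReal.ofReal_add h1 (by positivity), ← ENNReal.ofReal_add (by positivity)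
      (mul_nonneg (mul_nonneg ha0 ha1) h3),
    ← ENNReal.ofReal_add (mul_nonneg ha1 h4) (by positivity)]
  exact congrArg _ (wSq_identity hw1 a (q · z) (G · z))

lemma eq_zero_of_wSq_eq_zero {w : Fin K → ℝ} (hw : ∀ s, 0 < w s) {G : Fin K → ℝ}
    (h : wSq w G = 0) (s : Fin K) : G s = 0 := by
  have := (Finset.sum_eq_zero_iff_of_nonneg
    (fun s _ => mul_nonneg (hw s).le (sq_nonneg (G s)))).1 h s (Finset.mem_univ s)
  simpa [(hw s).ne'] using this

lemma ae_eq_zero_of_lintegral_wSq {m : Measure Z} {w : Fin K → ℝ} (hw : ∀ s, 0 < w s)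
    {G : Fin K → Z → ℝ} (hG : ∀ s, Measurable (G s))
    (h : ∫⁻ z, ENNReal.ofReal (wSq w (G · z)) ∂m = 0) : ∀ᵐ z ∂m, ∀ s, G s z = 0 := by
  filter_upwards [(lintegral_eq_zero_iff (measurable_wSq w hG).ennreal_ofReal).1 h] with z hz
  exact eq_zero_of_wSq_eq_zero hw
    (le_antisymm (ENNReal.ofReal_eq_zero.1 hz) (wSq_nonneg (fun s => (hw s).le) _))

/-- A family at distance at most `(1 - a) D` from `q` and at most `a D` from the constants, where
`D` is the distance from `q` to the constants, is the corresponding point of the segment between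
`q` and its mean. -/
lemma ae_eq_interpolation (m : Measure Z) {w : Fin K → ℝ} (hw : ∀ s, 0 < w s)
    (hw1 : ∑ s, w s = 1) {a : ℝ} (ha : a ∈ Icc (0 : ℝ) 1) {q G : Fin K → Z → ℝ}
    (hq : ∀ s, Measurable (q s)) (hG : ∀ s, Measurable (G s))
    (hD : ∫⁻ z, ENNReal.ofReal (wSq w fun s => q s z - wMean w (q · z)) ∂m ≠ ∞)
    (hA : ∫⁻ z, ENNReal.ofReal (wSq w fun s => q s z - G s z) ∂m ≤ ENNReal.ofReal ((1 - a) ^ 2) *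
      ∫⁻ z, ENNReal.ofReal (wSq w fun s => q s z - wMean w (q · z)) ∂m)
    (hB : ∫⁻ z, ENNReal.ofReal (wSq w fun s => G s z - wMean w (G · z)) ∂m ≤
      ENNReal.ofReal (a ^ 2) *
      ∫⁻ z, ENNReal.ofReal (wSq w fun s => q s z - wMean w (q · z)) ∂m) :
    ∀ᵐ z ∂m, ∀ s, G s z = a * q s z + (1 - a) * wMean w (q · z) := by
  have ha0 := ha.1
  have ha1 : 0 ≤ 1 - a := sub_nonneg.2 ha.2
  have hw0 : ∀ s, 0 ≤ w s := fun s => (hw s).le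
  have hmq := measurable_wMean w hq
  have hmG := measurable_wMean w hG
  have hid := lintegral_wSq_identity m hw0 hw1 ha hq hG
  set D := ∫⁻ z, ENNReal.ofReal (wSq w fun s => q s z - wMean w (q · z)) ∂m with hDdef
  -- (1-a)a² + a(1-a)² = a(1-a): the two upper bounds add up to exactly the last term on the left of
  -- the identity, so its other terms vanish.
  have hR : ENNReal.ofReal (1 - a) * (ENNReal.ofReal (a ^ 2) * D) +
      ENNReal.ofReal a * (ENNReal.ofReal ((1 - a) ^ 2) * D) = 0 + ENNReal.ofReal (a * (1 - a)) * D := by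
    rw [← mul_assoc, ← mul_assoc, ← ENNReal.ofReal_mul ha1, ← ENNReal.ofReal_mul ha0, ← add_mul,
      ← ENNReal.ofReal_add (by positivity) (by positivity), zero_add]
    congr 2
    ring
  have hle := hid.le.trans ((add_le_add (mul_le_mul_right hB _) (mul_le_mul_right hA _)).trans
    hR.le)
  have h0 := ENNReal.le_of_add_le_add_right (ENNReal.mul_ne_top ENNReal.ofReal_ne_top hD) hle
  have h1 : ∀ᵐ z ∂m, ∀ s, (G s z - wMean w (G · z)) - a * (q s z - wMean w (q · z)) = 0 :=
    ae_eq_zero_of_lintegral_wSq hw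
    (fun s => ((hG s).sub hmG).sub (((hq s).sub hmq).const_mul a))
    (le_antisymm (le_trans le_self_add h0) zero_le)
  -- In the identity the difference of means carries the factor a and is lost at a = 0. It is
  -- recovered by expanding the distance from q to G, now that the centred part of G is known.
  have hAeq : ∫⁻ z, ENNReal.ofReal (wSq w fun s => q s z - G s z) ∂m =
      ENNReal.ofReal ((1 - a) ^ 2) * D +
        ∫⁻ z, ENNReal.ofReal ((wMean w (q · z) - wMean w (G · z)) ^ 2) ∂m := by
    have m3 : Measurable fun z => wSq w fun s => q s z - wMean w (q · z) :=
      measurable_wSq w fun s => (hq s).sub hmq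
    rw [hDdef, ← lintegral_const_mul _ m3.ennreal_ofReal,
      ← lintegral_add_left (m3.ennreal_ofReal.const_mul _)]
    refine lintegral_congr_ae ?_
    filter_upwards [h1] with z hz
    have h3 := wSq_nonneg hw0 fun s => q s z - wMean w (q · z)
    rw [← ENNReal.ofReal_mul (by positivity), ← ENNReal.ofReal_add (by positivity) (by positivity)]
    congr 1
    have e : ∀ s, q s z - G s z = (1 - a) * (q s z - wMean w (q · z)) +
        (wMean w (q · z) - wMean w (G · z)) := fun s => by linarith [hz s]
    have key : ∀ s, w s * (q s z - G s z) ^ 2 =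
        (1 - a) ^ 2 * (w s * (q s z - wMean w (q · z)) ^ 2) +
        (2 * (1 - a) * (wMean w (q · z) - wMean w (G · z)) * (w s * (q s z - wMean w (q · z))) +
          w s * (wMean w (q · z) - wMean w (G · z)) ^ 2) := fun s => by rw [e s]; ring
    have h0 := sum_mul_sub_wMean hw1 (q · z)
    simp only [wSq, key, Finset.sum_add_distrib, ← Finset.mul_sum, ← Finset.sum_mul, hw1, h0]
    ring
  have h2 : ∫⁻ z, ENNReal.ofReal ((wMean w (q · z) - wMean w (G · z)) ^ 2) ∂m = 0 := by
    have hA' := hA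
    rw [hAeq, add_comm] at hA'
    nth_rewrite 2 [← zero_add (ENNReal.ofReal ((1 - a) ^ 2) * D)] at hA'
    exact le_antisymm (ENNReal.le_of_add_le_add_right
      (ENNReal.mul_ne_top ENNReal.ofReal_ne_top hD) hA') zero_le
  have h2' := (lintegral_eq_zero_iff ((hmq.sub hmG).pow_const 2).ennreal_ofReal).1 h2
  filter_upwards [h1, h2'] with z hz hz' s
  have hc : wMean w (q · z) - wMean w (G · z) = 0 := by
    have hle : (wMean w (q · z) - wMean w (G · z)) ^ 2 ≤ 0 := ENNReal.ofReal_eq_zero.1 hz'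
    exact (pow_eq_zero_iff two_ne_zero).1 (le_antisymm hle (sq_nonneg _))
  linarith [hz s]

end WeightedMean

/-! ### Conditional laws and the law of (X, S). -/

section Disintegration

variable {Ω 𝒳 𝒱 : Type*} [MeasurableSpace Ω]
  [MeasurableSpace 𝒳] [StandardBorelSpace 𝒳] [Nonempty 𝒳] [MeasurableSpace 𝒱] {K : ℕ}

/-- The standing assumptions on the features, the latent variable and the sensitive attribute. -/
structure IsCausalModel (P : Measure Ω) (X : Ω → 𝒳) (V : Ω → 𝒱) (S : Ω → Fin K)
    (ψ : 𝒳 × Fin K → 𝒱) : Prop where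
  measurable_X : Measurable X
  measurable_V : Measurable V
  measurable_S : Measurable S
  indep : IndepFun V S P
  weight_pos : ∀ s : Fin K, 0 < weight P S s
  measurable_ψ : Measurable ψ
  ae_eq : ∀ᵐ ω ∂P, V ω = ψ (X ω, S ω)

instance (P : Measure Ω) [IsFiniteMeasure P] (X : Ω → 𝒳) (V : Ω → 𝒱) (S : Ω → Fin K) :
    IsMarkovKernel (featureLaw P X V S) := by
  unfold featureLaw
  infer_instance

/-- The real-valued weight of a group. -/
noncomputable def realWeight (P : Measure Ω) (S : Ω → Fin K) (s : Fin K) : ℝ :=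
  (weight P S s).toReal

/-- The conditional laws `μ_{f ∣ v, s}` as a kernel in `v`. -/
noncomputable def predKernel (P : Measure Ω) [IsFiniteMeasure P] (X : Ω → 𝒳) (V : Ω → 𝒱)
    (S : Ω → Fin K) (f : 𝒳 × Fin K → ℝ) (s : Fin K) : Kernel 𝒱 ℝ :=
  ((featureLaw P X V S).comap (fun v => (v, s)) measurable_prodMk_right).map fun x => f (x, s)

/-- The conditional quantile functions `(v, u) ↦ Q_{f ∣ v, s}(u)`. -/
noncomputable def condQuantile (P : Measure Ω) [IsFiniteMeasure P] (X : Ω → 𝒳) (V : Ω → 𝒱)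
    (S : Ω → Fin K) (f : 𝒳 × Fin K → ℝ) (s : Fin K) (z : 𝒱 × ℝ) : ℝ :=
  quantile (predLaw P X V S f z.1 s) z.2

/-- The weighted mean of the conditional quantile functions. -/
noncomputable def meanQuantile (P : Measure Ω) [IsFiniteMeasure P] (X : Ω → 𝒳) (V : Ω → 𝒱)
    (S : Ω → Fin K) (f : 𝒳 × Fin K → ℝ) (z : 𝒱 × ℝ) : ℝ :=
  wMean (realWeight P S) fun s => condQuantile P X V S f s z

/-- The total weighted variance of the conditional quantile functions of `f`. -/
noncomputable def dispersion (P : Measure Ω) [IsFiniteMeasure P] (X : Ω → 𝒳) (V : Ω → 𝒱)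
    (S : Ω → Fin K) (f : 𝒳 × Fin K → ℝ) : ℝ≥0∞ :=
  ∫⁻ z, ENNReal.ofReal (wSq (realWeight P S) fun s =>
    condQuantile P X V S f s z - meanQuantile P X V S f z) ∂((P.map V).prod unitUniform)

/-- The predictor sending each prediction to the barycentre of its conditional laws. -/
noncomputable def fairPredictor (P : Measure Ω) [IsFiniteMeasure P] (X : Ω → 𝒳) (V : Ω → 𝒱)
    (S : Ω → Fin K) (ψ : 𝒳 × Fin K → 𝒱) (f : 𝒳 × Fin K → ℝ) (p : 𝒳 × Fin K) : ℝ :=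
  meanQuantile P X V S f (ψ p, cdf (predLaw P X V S f (ψ p) p.2) (f p))

variable {P : Measure Ω} [IsProbabilityMeasure P] {X : Ω → 𝒳} {V : Ω → 𝒱} {S : Ω → Fin K}
  {ψ : 𝒳 × Fin K → 𝒱} {f g : 𝒳 × Fin K → ℝ}

lemma measurable_slice (hf : Measurable f) (s : Fin K) : Measurable fun x => f (x, s) :=
  hf.comp measurable_prodMk_right

lemma predKernel_apply (hf : Measurable f) (s : Fin K) (v : 𝒱) :
    predKernel P X V S f s v = predLaw P X V S f v s := by
  rw [predKernel, Kernel.map_apply _ (measurable_slice hf s), Kernel.comap_apply]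
  rfl

lemma isMarkovKernel_predKernel (hf : Measurable f) (s : Fin K) :
    IsMarkovKernel (predKernel P X V S f s) :=
  Kernel.IsMarkovKernel.map _ (measurable_slice hf s)

lemma isProbabilityMeasure_predLaw (hf : Measurable f) (v : 𝒱) (s : Fin K) :
    IsProbabilityMeasure (predLaw P X V S f v s) :=
  Measure.isProbabilityMeasure_map (measurable_slice hf s).aemeasurable

lemma measurable_condQuantile (hf : Measurable f) (s : Fin K) :
    Measurable (condQuantile P X V S f s) := by
  have := isMarkovKernel_predKernel (P := P) (X := X) (V := V) (S := S) hf s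
  have h := measurable_quantile_comp (predKernel P X V S f s)
  simp_rw [predKernel_apply hf] at h
  exact h

lemma measurable_meanQuantile (hf : Measurable f) : Measurable (meanQuantile P X V S f) :=
  measurable_wMean _ fun s => measurable_condQuantile hf s

lemma measurable_fairPredictor (hψ : Measurable ψ) (hf : Measurable f) :
    Measurable (fairPredictor P X V S ψ f) := by
  refine measurable_from_prod_countable_left fun s => ?_
  have := isMarkovKernel_predKernel (P := P) (X := X) (V := V) (S := S) hf s
  have h := measurable_cdf_comp (predKernel P X V S f s)
  simp_rw [predKernel_apply hf] at h
  have hψs : Measurable fun x => ψ (x, s) := hψ.comp measurable_prodMk_right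
  exact (measurable_meanQuantile hf).comp
    (hψs.prodMk (h.comp (hψs.prodMk (measurable_slice hf s))))

lemma realWeight_nonneg (P : Measure Ω) (S : Ω → Fin K) (s : Fin K) : 0 ≤ realWeight P S s :=
  ENNReal.toReal_nonneg

lemma ofReal_realWeight (s : Fin K) : ENNReal.ofReal (realWeight P S s) = weight P S s :=
  ENNReal.ofReal_toReal (measure_ne_top _ _)

lemma lintegral_wSq {Z : Type*} [MeasurableSpace Z] (m : Measure Z) {G : Fin K → Z → ℝ}
    (hG : ∀ s, Measurable (G s)) :
    ∫⁻ z, ENNReal.ofReal (wSq (realWeight P S) (G · z)) ∂m =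
      ∑ s, weight P S s * ∫⁻ z, ENNReal.ofReal (G s z ^ 2) ∂m := by
  have h : ∀ z, ENNReal.ofReal (wSq (realWeight P S) (G · z)) =
      ∑ s, weight P S s * ENNReal.ofReal (G s z ^ 2) := fun z => by
    rw [wSq, ENNReal.ofReal_sum_of_nonneg fun s _ =>
      mul_nonneg (realWeight_nonneg P S s) (sq_nonneg _)]
    simp_rw [ENNReal.ofReal_mul (realWeight_nonneg P S _), ofReal_realWeight]
  simp_rw [h]
  rw [lintegral_finsetSum _ fun s _ => ((hG s).pow_const 2).ennreal_ofReal.const_mul _]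
  simp_rw [lintegral_const_mul _ ((hG _).pow_const 2).ennreal_ofReal]

namespace IsCausalModel

lemma realWeight_pos (h : IsCausalModel P X V S ψ) (s : Fin K) : 0 < realWeight P S s :=
  ENNReal.toReal_pos (h.weight_pos s).ne' (measure_ne_top _ _)

lemma map_S_singleton (h : IsCausalModel P X V S ψ) (s : Fin K) :
    P.map S {s} = weight P S s :=
  Measure.map_apply h.measurable_S (measurableSet_singleton s)

lemma sum_weight (h : IsCausalModel P X V S ψ) : ∑ s, weight P S s = 1 := by
  have := Measure.isProbabilityMeasure_map (μ := P) h.measurable_S.aemeasurable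
  simp_rw [← h.map_S_singleton]
  rw [sum_measure_singleton, Finset.coe_univ, measure_univ]

lemma sum_realWeight (h : IsCausalModel P X V S ψ) : ∑ s, realWeight P S s = 1 := by
  simp_rw [realWeight]
  rw [← ENNReal.toReal_sum (f := weight P S) fun s _ => measure_ne_top _ _, h.sum_weight, ENNReal.toReal_one]

lemma isProbabilityMeasure_map_V (h : IsCausalModel P X V S ψ) :
    IsProbabilityMeasure (P.map V) :=
  Measure.isProbabilityMeasure_map h.measurable_V.aemeasurable

/-- Independence enters here: the law of (V, S) is a product, so v can be drawn from ν for each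
group. -/
lemma compProd_featureLaw (h : IsCausalModel P X V S ψ) :
    ((P.map V).prod (P.map S)) ⊗ₘ featureLaw P X V S =
      P.map fun ω => ((V ω, S ω), X ω) := by
  rw [← h.indep.map_prod_eq_prod_map_map h.measurable_V.aemeasurable h.measurable_S.aemeasurable]
  exact compProd_map_condDistrib h.measurable_X.aemeasurable

/-- Every group has positive weight, so almost every s means every s. -/
lemma ae_featureLaw (h : IsCausalModel P X V S ψ) {φ : (𝒱 × Fin K) × 𝒳 → Prop}
    (hφ : ∀ᵐ t ∂(P.map fun ω => ((V ω, S ω), X ω)), φ t) :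
    ∀ᵐ v ∂(P.map V), ∀ s, ∀ᵐ x ∂(featureLaw P X V S (v, s)), φ ((v, s), x) := by
  rw [← h.compProd_featureLaw] at hφ
  filter_upwards [Measure.ae_ae_of_ae_prod (Measure.ae_ae_of_ae_compProd hφ)] with v hv s
  by_contra hs
  have h0 := measure_mono_null (singleton_subset_iff.2 hs) (ae_iff.1 hv)
  rw [h.map_S_singleton] at h0
  exact (h.weight_pos s).ne' h0

lemma ae_featureLaw_of_ae (h : IsCausalModel P X V S ψ) {φ : 𝒳 × Fin K → Prop}
    (hφ : ∀ᵐ p ∂(P.map fun ω => (X ω, S ω)), φ p) :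
    ∀ᵐ v ∂(P.map V), ∀ s, ∀ᵐ x ∂(featureLaw P X V S (v, s)), φ (x, s) := by
  refine h.ae_featureLaw (φ := fun t => φ (t.2, t.1.2)) ?_
  have hm : Measurable fun t : (𝒱 × Fin K) × 𝒳 => (t.2, t.1.2) := by fun_prop
  refine ae_of_ae_map (p := φ) hm.aemeasurable ?_
  rwa [Measure.map_map hm
    ((h.measurable_V.prodMk h.measurable_S).prodMk h.measurable_X)]

lemma ae_featureLaw_eq [StandardBorelSpace 𝒱] (h : IsCausalModel P X V S ψ) :
    ∀ᵐ v ∂(P.map V), ∀ s, ∀ᵐ x ∂(featureLaw P X V S (v, s)), ψ (x, s) = v := by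
  refine h.ae_featureLaw (φ := fun t => ψ (t.2, t.1.2) = t.1.1) ?_
  have hm : Measurable fun t : (𝒱 × Fin K) × 𝒳 => (t.2, t.1.2) := by fun_prop
  have hA : MeasurableSet {t : (𝒱 × Fin K) × 𝒳 | ψ (t.2, t.1.2) = t.1.1} :=
    measurableSet_eq_fun (h.measurable_ψ.comp hm) (by fun_prop)
  refine (ae_map_iff ((h.measurable_V.prodMk h.measurable_S).prodMk
    h.measurable_X).aemeasurable hA).2 ?_
  filter_upwards [h.ae_eq] with ω hω using hω.symm

lemma ae_comp_ψ (h : IsCausalModel P X V S ψ) {φ : 𝒱 → Prop} (hφ : ∀ᵐ v ∂(P.map V), φ v) :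
    ∀ᵐ p ∂(P.map fun ω => (X ω, S ω)), φ (ψ p) := by
  refine ae_of_ae_map h.measurable_ψ.aemeasurable ?_
  rw [Measure.map_map h.measurable_ψ (h.measurable_X.prodMk h.measurable_S)]
  rwa [Measure.map_congr h.ae_eq] at hφ

/-- Disintegration of the law of `(X, S)`. -/
lemma lintegral_featureLaw (h : IsCausalModel P X V S ψ) {F : 𝒳 × Fin K → ℝ≥0∞}
    (hF : Measurable F) :
    ∫⁻ v, ∑ s, weight P S s * ∫⁻ x, F (x, s) ∂(featureLaw P X V S (v, s)) ∂(P.map V) =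
      ∫⁻ p, F p ∂(P.map fun ω => (X ω, S ω)) := by
  have hm : Measurable fun t : (𝒱 × Fin K) × 𝒳 => (t.2, t.1.2) := by fun_prop
  have hVSX := (h.measurable_V.prodMk h.measurable_S).prodMk h.measurable_X
  have e : P.map (fun ω => (X ω, S ω)) = (P.map fun ω => ((V ω, S ω), X ω)).map
      fun t => (t.2, t.1.2) := by
    rw [Measure.map_map hm hVSX]
    rfl
  have hFm : Measurable fun t : (𝒱 × Fin K) × 𝒳 => F (t.2, t.1.2) := hF.comp hm
  rw [e, lintegral_map hF hm, ← h.compProd_featureLaw, Measure.lintegral_compProd hFm,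
    lintegral_prod _ (Measurable.lintegral_kernel_prod_right' hFm).aemeasurable]
  refine lintegral_congr fun v => ?_
  rw [lintegral_fintype]
  simp_rw [h.map_S_singleton, mul_comm (weight P S _)]

lemma ae_of_ae_featureLaw (h : IsCausalModel P X V S ψ) {A : Set (𝒳 × Fin K)}
    (hA : MeasurableSet A)
    (hae : ∀ᵐ v ∂(P.map V), ∀ s, ∀ᵐ x ∂(featureLaw P X V S (v, s)), (x, s) ∈ A) :
    ∀ᵐ p ∂(P.map fun ω => (X ω, S ω)), p ∈ A := by
  rw [ae_iff]
  change (P.map fun ω => (X ω, S ω)) Aᶜ = 0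
  rw [← lintegral_indicator_one hA.compl,
    ← h.lintegral_featureLaw (measurable_one.indicator hA.compl)]
  refine (lintegral_congr_ae ?_).trans lintegral_zero
  filter_upwards [hae] with v hv
  refine Finset.sum_eq_zero fun s _ => ?_
  rw [lintegral_congr_ae (g := 0), Pi.zero_def, lintegral_zero, mul_zero]
  filter_upwards [hv s] with x hx
  simp [hx]

lemma risk_eq (h : IsCausalModel P X V S ψ) (hf : Measurable f) (hg : Measurable g) :
    risk P X V S f g =
      ∫⁻ p, ENNReal.ofReal ((g p - f p) ^ 2) ∂(P.map fun ω => (X ω, S ω)) :=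
  h.lintegral_featureLaw ((hg.sub hf).pow_const 2).ennreal_ofReal

/-- Given V = v and S = s, almost every x satisfies ψ(x, s) = v, so one good x carries fairness at
(x, s) over to v. Conversely, ψ(X, S) has law ν. -/
lemma isCF_iff [StandardBorelSpace 𝒱] (h : IsCausalModel P X V S ψ) :
    IsCF P X V S ψ g ↔
      ∀ᵐ v ∂(P.map V), ∀ s s', predLaw P X V S g v s = predLaw P X V S g v s' := by
  constructor
  · intro hg
    filter_upwards [h.ae_featureLaw_of_ae hg, h.ae_featureLaw_eq] with v h1 h2 s s'
    obtain ⟨x, hx1, hx2⟩ := ((h1 s).and (h2 s)).exists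
    have := hx1 s'
    simp only [counterfactualLaw, hx2] at this
    exact this
  · intro hg
    filter_upwards [h.ae_comp_ψ hg] with p hp s'
    exact hp p.2 s'

lemma predLaw_congr (h : IsCausalModel P X V S ψ)
    (hfg : f =ᵐ[P.map fun ω => (X ω, S ω)] g) :
    ∀ᵐ v ∂(P.map V), ∀ s, predLaw P X V S f v s = predLaw P X V S g v s := by
  filter_upwards [h.ae_featureLaw_of_ae hfg] with v hv s
  exact Measure.map_congr (hv s)

lemma unfairness_congr (h : IsCausalModel P X V S ψ)
    (hfg : f =ᵐ[P.map fun ω => (X ω, S ω)] g) :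
    unfairness P X V S f = unfairness P X V S g := by
  refine lintegral_congr_ae ?_
  filter_upwards [h.predLaw_congr hfg] with v hv
  simp only [condUnfairness, hv]

lemma risk_congr (h : IsCausalModel P X V S ψ) {fstar : 𝒳 × Fin K → ℝ}
    (hfg : f =ᵐ[P.map fun ω => (X ω, S ω)] g) :
    risk P X V S fstar f = risk P X V S fstar g := by
  refine lintegral_congr_ae ?_
  filter_upwards [h.ae_featureLaw_of_ae hfg] with v hv
  refine Finset.sum_congr rfl fun s _ => ?_
  congr 1
  refine lintegral_congr_ae ?_
  filter_upwards [hv s] with x hx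
  rw [hx]

end IsCausalModel

end Disintegration

lemma le_of_sum_eq_sum {ι : Type*} [Fintype ι] {a b : ι → ℝ≥0∞} (hab : ∀ i, a i ≤ b i)
    (hb : ∀ i, b i ≠ ∞) (h : ∑ i, a i = ∑ i, b i) (i : ι) : b i ≤ a i := by
  classical
  rw [← Finset.add_sum_erase _ a (Finset.mem_univ i),
    ← Finset.add_sum_erase _ b (Finset.mem_univ i)] at h
  refine ENNReal.le_of_add_le_add_right
    (ENNReal.sum_ne_top.2 fun j _ => hb j : ∑ j ∈ Finset.univ.erase i, b j ≠ ∞) ?_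
  rw [← h]
  exact add_le_add le_rfl (Finset.sum_le_sum fun j _ => hab j)

/-! ### Lower bounds through quantile families. -/

section Optimality

variable {Ω 𝒳 𝒱 : Type*} [MeasurableSpace Ω]
  [MeasurableSpace 𝒳] [StandardBorelSpace 𝒳] [Nonempty 𝒳]
  [MeasurableSpace 𝒱] [StandardBorelSpace 𝒱] {K : ℕ}
  {P : Measure Ω} [IsProbabilityMeasure P] {X : Ω → 𝒳} {V : Ω → 𝒱} {S : Ω → Fin K}
  {ψ : 𝒳 × Fin K → 𝒱} {f g : 𝒳 × Fin K → ℝ}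

lemma measurable_condQuantile_right (hf : Measurable f) (s : Fin K) (v : 𝒱) :
    Measurable fun u => condQuantile P X V S f s (v, u) :=
  (measurable_condQuantile hf s).comp measurable_prodMk_left

lemma measurable_meanQuantile_right (hf : Measurable f) (v : 𝒱) :
    Measurable fun u => meanQuantile P X V S f (v, u) :=
  (measurable_meanQuantile hf).comp measurable_prodMk_left

lemma map_prodMk_mem_couplings (hf : Measurable f) (hg : Measurable g) (v : 𝒱) (s : Fin K) :
    (featureLaw P X V S (v, s)).map (fun x => (f (x, s), g (x, s))) ∈
      couplings (predLaw P X V S f v s) (predLaw P X V S g v s) := by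
  have hm := (measurable_slice hf s).prodMk (measurable_slice hg s)
  exact ⟨Measure.map_map measurable_fst hm, Measure.map_map measurable_snd hm⟩

lemma lintegral_map_prodMk (hf : Measurable f) (hg : Measurable g) (v : 𝒱) (s : Fin K) :
    ∫⁻ z, ENNReal.ofReal (|z.1 - z.2| ^ 2)
        ∂((featureLaw P X V S (v, s)).map fun x => (f (x, s), g (x, s))) =
      ∫⁻ x, ENNReal.ofReal ((g (x, s) - f (x, s)) ^ 2) ∂(featureLaw P X V S (v, s)) := by
  rw [lintegral_map (by fun_prop) ((measurable_slice hf s).prodMk (measurable_slice hg s))]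
  simp only [sq_abs, sub_sq_comm]

lemma W2sq_predLaw_le (hf : Measurable f) (hg : Measurable g) (v : 𝒱) (s : Fin K) :
    W2sq (predLaw P X V S f v s) (predLaw P X V S g v s) ≤
      ∫⁻ x, ENNReal.ofReal ((g (x, s) - f (x, s)) ^ 2) ∂(featureLaw P X V S (v, s)) := by
  rw [← lintegral_map_prodMk hf hg]
  exact iInf₂_le _ (map_prodMk_mem_couplings hf hg v s)

/-- The conditional joint law of the two predictions is a coupling, hence costs at least as much as
the comonotone one. -/
lemma lintegral_condQuantile_le (hf : Measurable f) (hg : Measurable g) (v : 𝒱) (s : Fin K) :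
    ∫⁻ u, ENNReal.ofReal ((condQuantile P X V S f s (v, u) - condQuantile P X V S g s (v, u)) ^ 2)
        ∂unitUniform ≤
      ∫⁻ x, ENNReal.ofReal ((g (x, s) - f (x, s)) ^ 2) ∂(featureLaw P X V S (v, s)) := by
  have := isProbabilityMeasure_predLaw (P := P) (X := X) (V := V) (S := S) hf v s
  have := isProbabilityMeasure_predLaw (P := P) (X := X) (V := V) (S := S) hg v s
  rw [← lintegral_map_prodMk hf hg]
  simp only [condQuantile]
  exact comonotone_cost_le (map_prodMk_mem_couplings hf hg v s)

lemma lintegral_wSq_condQuantile (hf : Measurable f) (hg : Measurable g) :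
    ∫⁻ z, ENNReal.ofReal (wSq (realWeight P S) fun s =>
        condQuantile P X V S f s z - condQuantile P X V S g s z) ∂((P.map V).prod unitUniform) =
      ∫⁻ v, ∑ s, weight P S s * ∫⁻ u, ENNReal.ofReal
        ((condQuantile P X V S f s (v, u) - condQuantile P X V S g s (v, u)) ^ 2) ∂unitUniform
        ∂(P.map V) := by
  have hm : ∀ s, Measurable fun z => condQuantile P X V S f s z - condQuantile P X V S g s z :=
    fun s => (measurable_condQuantile hf s).sub (measurable_condQuantile hg s)
  rw [lintegral_prod _ (measurable_wSq _ hm).ennreal_ofReal.aemeasurable]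
  refine lintegral_congr fun v => ?_
  exact lintegral_wSq unitUniform (G := fun s u =>
    condQuantile P X V S f s (v, u) - condQuantile P X V S g s (v, u))
    fun s => (hm s).comp measurable_prodMk_left

lemma lintegral_wSq_condQuantile_le_risk (hf : Measurable f) (hg : Measurable g) :
    ∫⁻ z, ENNReal.ofReal (wSq (realWeight P S) fun s =>
        condQuantile P X V S f s z - condQuantile P X V S g s z) ∂((P.map V).prod unitUniform) ≤
      risk P X V S f g := by
  rw [lintegral_wSq_condQuantile hf hg]
  refine lintegral_mono fun v => ?_
  exact Finset.sum_le_sum fun s _ => mul_le_mul_right (lintegral_condQuantile_le hf hg v s) _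

lemma dispersion_eq (hf : Measurable f) :
    dispersion P X V S f = ∫⁻ v, ∫⁻ u, ENNReal.ofReal (wSq (realWeight P S) fun s =>
      condQuantile P X V S f s (v, u) - meanQuantile P X V S f (v, u)) ∂unitUniform ∂(P.map V) :=
  lintegral_prod _ (measurable_wSq _ fun s => (measurable_condQuantile hf s).sub
    (measurable_meanQuantile hf)).ennreal_ofReal.aemeasurable

namespace IsCausalModel

/-- At each level u the weighted mean beats the quantile of any candidate barycentre. Neither
absence of atoms nor boundedness is needed, so every competitor is covered. -/
lemma dispersion_le_unfairness (h : IsCausalModel P X V S ψ) (hf : Measurable f) :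
    dispersion P X V S f ≤ unfairness P X V S f := by
  rw [dispersion_eq hf]
  refine lintegral_mono fun v => le_iInf₂ fun μ hμ => ?_
  have := hμ.1
  have hm : ∀ s, Measurable fun u => condQuantile P X V S f s (v, u) - quantile μ u :=
    fun s => (measurable_condQuantile_right hf s v).sub
      (measurable_quantile μ)
  calc ∫⁻ u, ENNReal.ofReal (wSq (realWeight P S) fun s =>
        condQuantile P X V S f s (v, u) - meanQuantile P X V S f (v, u)) ∂unitUniform
      ≤ ∫⁻ u, ENNReal.ofReal (wSq (realWeight P S) fun s =>
        condQuantile P X V S f s (v, u) - quantile μ u) ∂unitUniform := by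
        refine lintegral_mono fun u => ENNReal.ofReal_le_ofReal ?_
        have e : wSq (realWeight P S) (fun s => condQuantile P X V S f s (v, u) - quantile μ u) =
            wSq (realWeight P S) (fun s => condQuantile P X V S f s (v, u) -
              meanQuantile P X V S f (v, u)) + (meanQuantile P X V S f (v, u) - quantile μ u) ^ 2 :=
          wSq_sub_const h.sum_realWeight _ _
        linarith [sq_nonneg (meanQuantile P X V S f (v, u) - quantile μ u)]
    _ = ∑ s, weight P S s * ∫⁻ u, ENNReal.ofReal
        ((condQuantile P X V S f s (v, u) - quantile μ u) ^ 2) ∂unitUniform :=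
        lintegral_wSq unitUniform hm
    _ ≤ _ := by
        refine Finset.sum_le_sum fun s _ => mul_le_mul_right ?_ _
        have := isProbabilityMeasure_predLaw (P := P) (X := X) (V := V) (S := S) hf v s
        simp only [condQuantile]
        exact comonotone_cost_le_W2sq (predLaw P X V S f v s) μ

lemma ae_wMean_condQuantile_eq (h : IsCausalModel P X V S ψ) (hg : IsCF P X V S ψ g) :
    ∀ᵐ v ∂(P.map V), ∀ s u, condQuantile P X V S g s (v, u) = meanQuantile P X V S g (v, u) := by
  filter_upwards [h.isCF_iff.1 hg] with v hv s u
  have e : ∀ s', condQuantile P X V S g s' (v, u) = condQuantile P X V S g s (v, u) := fun s' => by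
    simp only [condQuantile, hv s' s]
  simp only [meanQuantile, wMean, e, ← Finset.sum_mul, h.sum_realWeight, one_mul]

lemma dispersion_eq_zero (h : IsCausalModel P X V S ψ) (hgm : Measurable g)
    (hg : IsCF P X V S ψ g) : dispersion P X V S g = 0 := by
  rw [dispersion_eq hgm]
  refine (lintegral_congr_ae ?_).trans lintegral_zero
  filter_upwards [h.ae_wMean_condQuantile_eq hg] with v hv
  simp [hv, wSq]

end IsCausalModel

lemma HasContinuousBoundedPredictions.nonatomic (hc : HasContinuousBoundedPredictions P X V S f) :
    ∀ᵐ v ∂(P.map V), ∀ s t, predLaw P X V S f v s {t} = 0 := by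
  obtain ⟨M, -, hM⟩ := hc
  filter_upwards [hM] with v hv s using (hv s).1

lemma ae_abs_condQuantile_le (hf : Measurable f) {M : ℝ} {v : 𝒱} {s : Fin K}
    (h : predLaw P X V S f v s (Icc (-M) M)ᶜ = 0) :
    ∀ᵐ u ∂unitUniform, |condQuantile P X V S f s (v, u)| ≤ M := by
  have := isProbabilityMeasure_predLaw (P := P) (X := X) (V := V) (S := S) hf v s
  have h' : ∀ᵐ t ∂(predLaw P X V S f v s), t ∈ Icc (-M) M := h
  rw [← map_quantile (predLaw P X V S f v s)] at h'
  filter_upwards [ae_of_ae_map (measurable_quantile _).aemeasurable h'] with u hu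
  exact abs_le.2 hu

namespace IsCausalModel

lemma abs_meanQuantile_le (h : IsCausalModel P X V S ψ) {M : ℝ} {z : 𝒱 × ℝ}
    (hz : ∀ s, |condQuantile P X V S f s z| ≤ M) : |meanQuantile P X V S f z| ≤ M := by
  change |∑ s, realWeight P S s * condQuantile P X V S f s z| ≤ M
  refine (Finset.abs_sum_le_sum_abs _ _).trans ?_
  calc ∑ s, |realWeight P S s * condQuantile P X V S f s z|
      ≤ ∑ s, realWeight P S s * M := by
        refine Finset.sum_le_sum fun s _ => ?_
        rw [abs_mul, abs_of_nonneg (realWeight_nonneg P S s)]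
        exact mul_le_mul_of_nonneg_left (hz s) (realWeight_nonneg P S s)
    _ = M := by rw [← Finset.sum_mul, h.sum_realWeight, one_mul]

lemma dispersion_lt_top (h : IsCausalModel P X V S ψ) (hf : Measurable f)
    (hc : HasContinuousBoundedPredictions P X V S f) : dispersion P X V S f < ∞ := by
  obtain ⟨M, hM0, hM⟩ := hc
  have := h.isProbabilityMeasure_map_V
  rw [dispersion_eq hf]
  refine lt_of_le_of_lt (b := ENNReal.ofReal (4 * M ^ 2)) ?_ ENNReal.ofReal_lt_top
  refine (lintegral_mono_ae (g := fun _ => ENNReal.ofReal (4 * M ^ 2)) ?_).trans (by simp)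
  filter_upwards [hM] with v hv
  refine (lintegral_mono_ae (g := fun _ => ENNReal.ofReal (4 * M ^ 2)) ?_).trans (by simp)
  filter_upwards [ae_all_iff.2 fun s => ae_abs_condQuantile_le hf (hv s).2] with u hu
  refine ENNReal.ofReal_le_ofReal ?_
  have hb := abs_le.1 (h.abs_meanQuantile_le hu)
  calc ∑ s, realWeight P S s *
        (condQuantile P X V S f s (v, u) - meanQuantile P X V S f (v, u)) ^ 2
      ≤ ∑ s, realWeight P S s * (4 * M ^ 2) := by
        refine Finset.sum_le_sum fun s _ =>
          mul_le_mul_of_nonneg_left ?_ (realWeight_nonneg P S s)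
        have hs := abs_le.1 (hu s)
        nlinarith [hs.1, hs.2, hb.1, hb.2]
    _ = 4 * M ^ 2 := by rw [← Finset.sum_mul, h.sum_realWeight, one_mul]

/-! ### The fair predictor attains the bounds. -/

/-- Given `V = v` and `S = s`, the fair predictor is a function of the prediction. -/
lemma ae_fairPredictor_eq (h : IsCausalModel P X V S ψ) :
    ∀ᵐ v ∂(P.map V), ∀ s, ∀ᵐ x ∂(featureLaw P X V S (v, s)),
      fairPredictor P X V S ψ f (x, s) =
        meanQuantile P X V S f (v, cdf (predLaw P X V S f v s) (f (x, s))) := by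
  filter_upwards [h.ae_featureLaw_eq] with v hv s
  filter_upwards [hv s] with x hx
  rw [fairPredictor, hx]

lemma map_prodMk_fairPredictor (h : IsCausalModel P X V S ψ) (hf : Measurable f)
    (hc : HasContinuousBoundedPredictions P X V S f) :
    ∀ᵐ v ∂(P.map V), ∀ s, (featureLaw P X V S (v, s)).map
      (fun x => (f (x, s), fairPredictor P X V S ψ f (x, s))) =
      unitUniform.map fun u => (condQuantile P X V S f s (v, u),
        meanQuantile P X V S f (v, u)) := by
  filter_upwards [h.ae_fairPredictor_eq (f := f), hc.nonatomic] with v hv hna s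
  have := isProbabilityMeasure_predLaw (P := P) (X := X) (V := V) (S := S) hf v s
  have hT : Measurable fun t : ℝ => (t, meanQuantile P X V S f
      (v, cdf (predLaw P X V S f v s) t)) :=
    measurable_id.prodMk ((measurable_meanQuantile hf).comp
      (measurable_const.prodMk (monotone_cdf _).measurable))
  have e : (fun x => (f (x, s), fairPredictor P X V S ψ f (x, s))) =ᵐ[featureLaw P X V S (v, s)]
      (fun t : ℝ => (t, meanQuantile P X V S f (v, cdf (predLaw P X V S f v s) t))) ∘
        fun x => f (x, s) := by
    filter_upwards [hv s] with x hx
    simp only [hx, Function.comp]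
  rw [Measure.map_congr e, ← Measure.map_map hT (measurable_slice hf s)]
  change (predLaw P X V S f v s).map _ = _
  -- The prediction is represented as the quantile at a uniform u; without atoms the distribution
  -- function returns u itself.
  have hq : ∀ T : ℝ → ℝ × ℝ, (predLaw P X V S f v s).map T =
      (unitUniform.map (quantile (predLaw P X V S f v s))).map T := fun T => by
    rw [map_quantile]
  rw [hq, Measure.map_map hT (measurable_quantile _)]
  refine Measure.map_congr ?_
  filter_upwards [ae_unitUniform_mem] with u hu
  simp only [Function.comp, cdf_quantile (hna s) hu]
  rfl

lemma predLaw_fairPredictor (h : IsCausalModel P X V S ψ) (hf : Measurable f)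
    (hc : HasContinuousBoundedPredictions P X V S f) :
    ∀ᵐ v ∂(P.map V), ∀ s, predLaw P X V S (fairPredictor P X V S ψ f) v s =
      unitUniform.map fun u => meanQuantile P X V S f (v, u) := by
  filter_upwards [h.map_prodMk_fairPredictor hf hc] with v hv s
  have h1 := (map_prodMk_mem_couplings (P := P) (X := X) (V := V) (S := S) hf
    (measurable_fairPredictor (P := P) (X := X) (V := V) (S := S) h.measurable_ψ hf) v s).2
  rw [hv s, Measure.map_map measurable_snd
    ((measurable_condQuantile_right hf s v).prodMk
      (measurable_meanQuantile_right hf v))] at h1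
  exact h1.symm

lemma isCF_fairPredictor (h : IsCausalModel P X V S ψ) (hf : Measurable f)
    (hc : HasContinuousBoundedPredictions P X V S f) :
    IsCF P X V S ψ (fairPredictor P X V S ψ f) := by
  rw [h.isCF_iff]
  filter_upwards [h.predLaw_fairPredictor hf hc] with v hv s s'
  rw [hv s, hv s']

lemma risk_fairPredictor (h : IsCausalModel P X V S ψ) (hf : Measurable f)
    (hc : HasContinuousBoundedPredictions P X V S f) :
    risk P X V S f (fairPredictor P X V S ψ f) = dispersion P X V S f := by
  rw [dispersion_eq hf]
  refine lintegral_congr_ae ?_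
  filter_upwards [h.map_prodMk_fairPredictor hf hc] with v hv
  have hm : ∀ s, Measurable fun u => condQuantile P X V S f s (v, u) -
      meanQuantile P X V S f (v, u) := fun s =>
    (measurable_condQuantile_right hf s v).sub
      (measurable_meanQuantile_right hf v)
  refine Eq.trans ?_ (lintegral_wSq unitUniform hm).symm
  refine Finset.sum_congr rfl fun s _ => ?_
  rw [← lintegral_map_prodMk hf (measurable_fairPredictor h.measurable_ψ hf), hv s,
    lintegral_map (by fun_prop) ((measurable_condQuantile_right hf s v).prodMk (measurable_meanQuantile_right hf v))]
  simp only [sq_abs]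

lemma map_meanQuantile_mem_P2 (h : IsCausalModel P X V S ψ) (hf : Measurable f)
    (hc : HasContinuousBoundedPredictions P X V S f) :
    ∀ᵐ v ∂(P.map V), (unitUniform.map fun u => meanQuantile P X V S f (v, u)) ∈ P2 := by
  obtain ⟨M, hM0, hM⟩ := hc
  filter_upwards [hM] with v hv
  have hm : Measurable fun u => meanQuantile P X V S f (v, u) :=
    measurable_meanQuantile_right hf v
  refine ⟨Measure.isProbabilityMeasure_map hm.aemeasurable, ?_⟩
  rw [memLp_map_measure_iff (by fun_prop) hm.aemeasurable]
  refine MemLp.of_bound hm.aestronglyMeasurable M ?_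
  filter_upwards [ae_all_iff.2 fun s => ae_abs_condQuantile_le hf (hv s).2] with u hu
  exact h.abs_meanQuantile_le hu

/-! ### Interpolated predictors. -/

lemma risk_relaxedPredictor (h : IsCausalModel P X V S ψ) (hf : Measurable f)
    (hg : Measurable g) (α : ℝ) :
    risk P X V S f (relaxedPredictor α f g) =
      ENNReal.ofReal ((1 - √α) ^ 2) * risk P X V S f g := by
  have hr : Measurable (relaxedPredictor α f g) := (hf.const_mul _).add (hg.const_mul _)
  rw [h.risk_eq hf hr, h.risk_eq hf hg, ← lintegral_const_mul' _ _ ENNReal.ofReal_ne_top]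
  refine lintegral_congr fun p => ?_
  rw [← ENNReal.ofReal_mul (sq_nonneg _)]
  congr 1
  simp only [relaxedPredictor]
  ring

/-- The law of the fair predictor serves as candidate barycentre, and the relaxed predictor differs
from it by √α times the gap between f and the fair predictor. -/
lemma unfairness_relaxedPredictor_le (h : IsCausalModel P X V S ψ) (hf : Measurable f)
    (hc : HasContinuousBoundedPredictions P X V S f) {α : ℝ} (hα : 0 ≤ α) :
    unfairness P X V S (relaxedPredictor α f (fairPredictor P X V S ψ f)) ≤
      ENNReal.ofReal α * dispersion P X V S f := by
  have hg := measurable_fairPredictor (P := P) (X := X) (V := V) (S := S) h.measurable_ψ hf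
  have hr : Measurable (relaxedPredictor α f (fairPredictor P X V S ψ f)) :=
    (hf.const_mul _).add (hg.const_mul _)
  rw [← h.risk_fairPredictor hf hc, risk, ← lintegral_const_mul' _ _ ENNReal.ofReal_ne_top]
  refine lintegral_mono_ae ?_
  filter_upwards [h.map_meanQuantile_mem_P2 hf hc, h.predLaw_fairPredictor hf hc] with v hv1 hv2
  refine (iInf₂_le _ hv1).trans ?_
  rw [condRisk, Finset.mul_sum]
  refine Finset.sum_le_sum fun s _ => ?_
  rw [mul_left_comm, ← hv2 s]
  refine mul_le_mul_right ((W2sq_predLaw_le hr hg v s).trans_eq ?_) _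
  rw [← lintegral_const_mul' _ _ ENNReal.ofReal_ne_top]
  refine lintegral_congr fun x => ?_
  rw [← ENNReal.ofReal_mul hα]
  congr 1
  have hsq := Real.sq_sqrt hα
  simp only [relaxedPredictor]
  linear_combination (fairPredictor P X V S ψ f (x, s) - f (x, s)) ^ 2 * hsq

lemma unfairness_eq_dispersion (h : IsCausalModel P X V S ψ) (hf : Measurable f)
    (hc : HasContinuousBoundedPredictions P X V S f) :
    unfairness P X V S f = dispersion P X V S f := by
  refine le_antisymm ?_ (h.dispersion_le_unfairness hf)
  have h1 := h.unfairness_relaxedPredictor_le hf hc zero_le_one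
  have e : relaxedPredictor 1 f (fairPredictor P X V S ψ f) = f := by
    ext p
    simp [relaxedPredictor]
  rwa [e, ENNReal.ofReal_one, one_mul] at h1

/-- A reverse triangle inequality: the relaxed predictor is too close to f to be nearer the
constants. It comes from the Stewart identity with a = √α, without computing the quantiles of the
relaxed predictor. -/
lemma le_unfairness_relaxedPredictor (h : IsCausalModel P X V S ψ) (hf : Measurable f)
    (hc : HasContinuousBoundedPredictions P X V S f) {α : ℝ} (hα : α ∈ Icc (0 : ℝ) 1) :
    ENNReal.ofReal α * dispersion P X V S f ≤
      unfairness P X V S (relaxedPredictor α f (fairPredictor P X V S ψ f)) := by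
  have hg := measurable_fairPredictor (P := P) (X := X) (V := V) (S := S) h.measurable_ψ hf
  have hr : Measurable (relaxedPredictor α f (fairPredictor P X V S ψ f)) :=
    (hf.const_mul _).add (hg.const_mul _)
  -- α = 1 is separate because the argument cancels the factor 1 - √α.
  rcases eq_or_lt_of_le hα.2 with rfl | hα1
  · have e : relaxedPredictor 1 f (fairPredictor P X V S ψ f) = f := by
      ext p
      simp [relaxedPredictor]
    rw [e, ENNReal.ofReal_one, one_mul]
    exact h.dispersion_le_unfairness hf
  refine le_trans ?_ (h.dispersion_le_unfairness hr)
  have ha0 := Real.sqrt_nonneg α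
  have ha1 : √α < 1 := by rwa [Real.sqrt_lt' one_pos, one_pow]
  have hD := (h.dispersion_lt_top hf hc).ne
  have hEA := lintegral_wSq_condQuantile_le_risk (P := P) (X := X) (V := V) (S := S) hf hr
  rw [h.risk_relaxedPredictor hf hg, h.risk_fairPredictor hf hc] at hEA
  have hid := lintegral_wSq_identity ((P.map V).prod unitUniform) (realWeight_nonneg P S)
    h.sum_realWeight ⟨ha0, ha1.le⟩ (fun s => measurable_condQuantile (P := P) (X := X) (V := V)
    (S := S) hf s) (fun s => measurable_condQuantile (P := P) (X := X) (V := V) (S := S) hr s)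
  have hle := (le_add_self.trans_eq hid).trans (add_le_add le_rfl (mul_le_mul_right hEA _))
  change ENNReal.ofReal (√α * (1 - √α)) * dispersion P X V S f ≤ ENNReal.ofReal (1 - √α) *
    dispersion P X V S (relaxedPredictor α f (fairPredictor P X V S ψ f)) + _ at hle
  have e : ENNReal.ofReal (√α * (1 - √α)) * dispersion P X V S f =
      ENNReal.ofReal (1 - √α) * (ENNReal.ofReal α * dispersion P X V S f) +
      ENNReal.ofReal √α * (ENNReal.ofReal ((1 - √α) ^ 2) * dispersion P X V S f) := by
    have ha1' : 0 ≤ 1 - √α := by linarith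
    rw [← mul_assoc, ← mul_assoc, ← ENNReal.ofReal_mul ha1', ← ENNReal.ofReal_mul ha0, ← add_mul,
      ← ENNReal.ofReal_add (mul_nonneg ha1' hα.1) (by positivity)]
    congr 2
    have hsq := Real.sq_sqrt hα.1
    linear_combination (1 - √α) * hsq
  rw [e] at hle
  have hle' := ENNReal.le_of_add_le_add_right (ENNReal.mul_ne_top ENNReal.ofReal_ne_top
    (ENNReal.mul_ne_top ENNReal.ofReal_ne_top hD)) hle
  exact (ENNReal.mul_le_mul_iff_right (ENNReal.ofReal_pos.2 (by linarith)).ne'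
    ENNReal.ofReal_ne_top).1 hle'

/-- A predictor whose risk and dispersion are at most those of a relaxed predictor coincides with
it. -/
lemma ae_eq_relaxedPredictor (h : IsCausalModel P X V S ψ) (hf : Measurable f)
    (hc : HasContinuousBoundedPredictions P X V S f) {α : ℝ} (hα : α ∈ Icc (0 : ℝ) 1)
    (hg : Measurable g)
    (hrisk : risk P X V S f g ≤ ENNReal.ofReal ((1 - √α) ^ 2) * dispersion P X V S f)
    (hdisp : dispersion P X V S g ≤ ENNReal.ofReal α * dispersion P X V S f) :
    g =ᵐ[P.map fun ω => (X ω, S ω)] relaxedPredictor α f (fairPredictor P X V S ψ f) := by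
  have hfair := measurable_fairPredictor (P := P) (X := X) (V := V) (S := S) h.measurable_ψ hf
  have hr : Measurable (relaxedPredictor α f (fairPredictor P X V S ψ f)) :=
    (hf.const_mul _).add (hfair.const_mul _)
  have hD := (h.dispersion_lt_top hf hc).ne
  have hq := fun s => measurable_condQuantile (P := P) (X := X) (V := V) (S := S) hf s
  have hG := fun s => measurable_condQuantile (P := P) (X := X) (V := V) (S := S) hg s
  have hV := h.isProbabilityMeasure_map_V
  have hG_eq : ∀ᵐ z ∂((P.map V).prod unitUniform), ∀ s, condQuantile P X V S g s z =
      √α * condQuantile P X V S f s z + (1 - √α) * meanQuantile P X V S f z := by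
    refine ae_eq_interpolation _ h.realWeight_pos h.sum_realWeight
      ⟨Real.sqrt_nonneg α, Real.sqrt_le_one.2 hα.2⟩ hq hG hD
      ((lintegral_wSq_condQuantile_le_risk hf hg).trans hrisk) ?_
    rw [Real.sq_sqrt hα.1]
    exact hdisp
  -- The quantile distance already equals the upper bound on the risk. The inequality between them
  -- is thus an equality, for almost every v and then for each s.
  have hEA : ∫⁻ z, ENNReal.ofReal (wSq (realWeight P S) fun s =>
      condQuantile P X V S f s z - condQuantile P X V S g s z) ∂((P.map V).prod unitUniform) =
      ENNReal.ofReal ((1 - √α) ^ 2) * dispersion P X V S f := by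
    rw [dispersion, ← lintegral_const_mul' _ _ ENNReal.ofReal_ne_top]
    refine lintegral_congr_ae ?_
    filter_upwards [hG_eq] with z hz
    rw [← ENNReal.ofReal_mul (sq_nonneg _), wSq, wSq, Finset.mul_sum]
    congr 1
    refine Finset.sum_congr rfl fun s _ => ?_
    rw [hz s]
    ring
  have hEA_ne := ENNReal.mul_ne_top (ENNReal.ofReal_ne_top (r := (1 - √α) ^ 2)) hD
  rw [← hEA] at hrisk hEA_ne
  rw [lintegral_wSq_condQuantile hf hg] at hrisk hEA_ne
  have hR_meas : Measurable (condRisk P X V S f g) :=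
    Finset.measurable_sum _ fun s _ => (Measurable.lintegral_kernel (κ := (featureLaw P X V S).comap
      (fun v => (v, s)) measurable_prodMk_right)
      ((measurable_slice hg s).sub (measurable_slice hf s) |>.pow_const 2).ennreal_ofReal).const_mul _
  have hcond := ae_eq_of_ae_le_of_lintegral_le (Eventually.of_forall fun v =>
    Finset.sum_le_sum fun s _ => mul_le_mul_right (lintegral_condQuantile_le hf hg v s) _)
    hEA_ne hR_meas.aemeasurable hrisk
  have hlt : ∀ᵐ v ∂(P.map V), condRisk P X V S f g v < ∞ :=
    ae_lt_top hR_meas (hrisk.trans_lt hEA_ne.lt_top).ne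
  refine h.ae_of_ae_featureLaw (measurableSet_eq_fun hg hr) ?_
  filter_upwards [hcond, hlt, Measure.ae_ae_of_ae_prod hG_eq, h.map_prodMk_fairPredictor hf hc,
    h.ae_fairPredictor_eq (f := f)] with v hv hvlt hvG hvmap hvfair s
  have hμ := isProbabilityMeasure_predLaw (P := P) (X := X) (V := V) (S := S) hf v s
  have hη := isProbabilityMeasure_predLaw (P := P) (X := X) (V := V) (S := S) hg v s
  have hs_ne : weight P S s ≠ ∞ := measure_ne_top _ _
  have hfin : ∀ t, weight P S t * ∫⁻ x, ENNReal.ofReal ((g (x, t) - f (x, t)) ^ 2)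
      ∂(featureLaw P X V S (v, t)) ≠ ∞ := fun t =>
    ((ENNReal.sum_lt_top.1 hvlt) t (Finset.mem_univ t)).ne
  have hterm : ∫⁻ x, ENNReal.ofReal ((g (x, s) - f (x, s)) ^ 2) ∂(featureLaw P X V S (v, s)) ≤
      ∫⁻ u, ENNReal.ofReal ((condQuantile P X V S f s (v, u) -
        condQuantile P X V S g s (v, u)) ^ 2) ∂unitUniform := by
    have hle : ∀ t, weight P S t * ∫⁻ u, ENNReal.ofReal ((condQuantile P X V S f t (v, u) -
        condQuantile P X V S g t (v, u)) ^ 2) ∂unitUniform ≤ weight P S t * ∫⁻ x,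
        ENNReal.ofReal ((g (x, t) - f (x, t)) ^ 2) ∂(featureLaw P X V S (v, t)) :=
      fun t => mul_le_mul_right (lintegral_condQuantile_le hf hg v t) _
    exact (ENNReal.mul_le_mul_iff_right (h.weight_pos s).ne' hs_ne).1
      (le_of_sum_eq_sum hle hfin hv s)
  have hopt := eq_comonotone_of_cost_le (map_prodMk_mem_couplings hf hg v s)
    (ne_top_of_le_ne_top (fun htop => hfin s (by
      rw [htop]; exact ENNReal.mul_top (h.weight_pos s).ne'))
      (lintegral_condQuantile_le hf hg v s)) (by rwa [lintegral_map_prodMk hf hg])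
  have hT : Measurable fun t : ℝ => √α * t + (1 - √α) *
      meanQuantile P X V S f (v, cdf (predLaw P X V S f v s) t) :=
    (measurable_id.const_mul _).add (((measurable_meanQuantile hf).comp
      (measurable_const.prodMk (monotone_cdf _).measurable)).const_mul _)
  -- Both pairs have the comonotone law, since the quantiles of g are the interpolated ones.
  have hsame : (featureLaw P X V S (v, s)).map (fun x => (f (x, s), g (x, s))) =
      (featureLaw P X V S (v, s)).map (fun x => (f (x, s),
        relaxedPredictor α f (fairPredictor P X V S ψ f) (x, s))) := by
    have hL : Measurable fun z : ℝ × ℝ => (z.1, √α * z.1 + (1 - √α) * z.2) := by fun_prop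
    have e1 : (fun x => (f (x, s), relaxedPredictor α f (fairPredictor P X V S ψ f) (x, s))) =
        (fun z : ℝ × ℝ => (z.1, √α * z.1 + (1 - √α) * z.2)) ∘
          fun x => (f (x, s), fairPredictor P X V S ψ f (x, s)) := rfl
    rw [e1, ← Measure.map_map hL ((measurable_slice hf s).prodMk (measurable_slice hfair s)),
      hvmap s, Measure.map_map hL ((measurable_condQuantile_right hf s v).prodMk (measurable_meanQuantile_right hf v)), hopt, comonotone]
    refine Measure.map_congr ?_
    filter_upwards [hvG] with u hu
    exact Prod.ext rfl (hu s)
  have hA : MeasurableSet {z : ℝ × ℝ | z.2 = √α * z.1 + (1 - √α) *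
      meanQuantile P X V S f (v, cdf (predLaw P X V S f v s) z.1)} :=
    measurableSet_eq_fun measurable_snd (hT.comp measurable_fst)
  -- The relaxed predictor is a function of f given v and s. Its pair with f lives on a graph, and
  -- so does any pair with the same law; this turns equality in law into almost sure equality.
  have hgraph := (ae_map_iff ((measurable_slice hf s).prodMk
    (measurable_slice hr s)).aemeasurable hA).2 (by
      filter_upwards [hvfair s] with x hx
      simp only [relaxedPredictor, hx])
  rw [← hsame] at hgraph
  filter_upwards [hvfair s, ae_of_ae_map ((measurable_slice hf s).prodMk
    (measurable_slice hg s)).aemeasurable hgraph] with x hx1 hx2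
  change g (x, s) = relaxedPredictor α f (fairPredictor P X V S ψ f) (x, s)
  rw [relaxedPredictor, hx1]
  exact hx2

end IsCausalModel

end Optimality

end Lemmas

end CounterfactualFairness

/-! ### The main theorem. -/

theorem proposition3 {Ω 𝒳 𝒱 : Type*} [MeasurableSpace Ω]
    [MeasurableSpace 𝒳] [StandardBorelSpace 𝒳] [Nonempty 𝒳]
    [MeasurableSpace 𝒱] [StandardBorelSpace 𝒱] {K : ℕ}
    (P : Measure Ω) [IsProbabilityMeasure P]
    (X : Ω → 𝒳) (V : Ω → 𝒱) (S : Ω → Fin K) (Y : Ω → ℝ)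
    (hX : Measurable X) (hV : Measurable V) (hS : Measurable S) (hY : Integrable Y P)
    (hVS : IndepFun V S P)
    (hw : ∀ s : Fin K, 0 < weight P S s)
    (ψ : 𝒳 × Fin K → 𝒱) (hψ : Measurable ψ)
    (hψV : ∀ᵐ ω ∂P, V ω = ψ (X ω, S ω))
    (fstar : 𝒳 × Fin K → ℝ) (hfstar : IsBayesPredictor P X S Y fstar)
    (hprop : HasContinuousBoundedPredictions P X V S fstar)
    (α : ℝ) (hα : α ∈ Set.Icc (0 : ℝ) 1) :
    unfairness P X V S fstar < ∞ ∧
    (∃ f0 : 𝒳 × Fin K → ℝ, IsFairOptimal P X V S ψ fstar f0) ∧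
    ∀ f0 : 𝒳 × Fin K → ℝ, IsFairOptimal P X V S ψ fstar f0 →
      risk P X V S fstar f0 < ∞ ∧
      IsRelaxedOptimal P X V S fstar α (relaxedPredictor α fstar f0) ∧
      (∀ g : 𝒳 × Fin K → ℝ, IsRelaxedOptimal P X V S fstar α g →
        g =ᵐ[P.map (fun ω => (X ω, S ω))] relaxedPredictor α fstar f0) ∧
      risk P X V S fstar (relaxedPredictor α fstar f0) =
        ENNReal.ofReal ((1 - √α) ^ 2) * risk P X V S fstar f0 ∧
      unfairness P X V S (relaxedPredictor α fstar f0) =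
        ENNReal.ofReal α * unfairness P X V S fstar := by
  have h : IsCausalModel P X V S ψ := ⟨hX, hV, hS, hVS, hw, hψ, hψV⟩
  have hf := hfstar.1
  have hD := h.dispersion_lt_top hf hprop
  have hU := h.unfairness_eq_dispersion hf hprop
  have hfair := measurable_fairPredictor (P := P) (X := X) (V := V) (S := S) hψ hf
  have hcf := h.isCF_fairPredictor hf hprop
  have hrisk_fair := h.risk_fairPredictor hf hprop
  have hzero : relaxedPredictor 0 fstar (fairPredictor P X V S ψ fstar) =
      fairPredictor P X V S ψ fstar := by
    ext p
    simp [relaxedPredictor]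
  -- The case α = 0 of the uniqueness result, which applies because CF predictors have dispersion
  -- zero.
  have huniq : ∀ g : 𝒳 × Fin K → ℝ, Measurable g → IsCF P X V S ψ g →
      risk P X V S fstar g ≤ dispersion P X V S fstar →
      g =ᵐ[P.map fun ω => (X ω, S ω)] fairPredictor P X V S ψ fstar := by
    intro g hg hgcf hle
    have := h.ae_eq_relaxedPredictor hf hprop (α := 0) (by simp) hg (by simpa using hle)
      (by rw [h.dispersion_eq_zero hg hgcf]; exact zero_le)
    rwa [hzero] at this
  refine ⟨hU ▸ hD, ⟨fairPredictor P X V S ψ fstar, ⟨hfair, hcf⟩, fun g hg hgcf => ?_⟩,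
    fun f0 hf0 => ?_⟩
  · rw [hrisk_fair]
    -- Optimality from uniqueness: a competitor with no larger risk agrees almost surely, so its
    -- risk is the same.
    rcases le_total (dispersion P X V S fstar) (risk P X V S fstar g) with hle | hle
    · exact hle
    · rw [h.risk_congr (huniq g hg hgcf hle), hrisk_fair]
  have hf0_ae := huniq f0 hf0.1.1 hf0.1.2 (hrisk_fair ▸ hf0.2 _ hfair hcf)
  have hrisk0 : risk P X V S fstar f0 = dispersion P X V S fstar := by
    rw [h.risk_congr hf0_ae, hrisk_fair]
  have hrel_ae : relaxedPredictor α fstar f0 =ᵐ[P.map fun ω => (X ω, S ω)]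
      relaxedPredictor α fstar (fairPredictor P X V S ψ fstar) := by
    filter_upwards [hf0_ae] with p hp
    simp only [relaxedPredictor, hp]
  have hrel_meas : Measurable (relaxedPredictor α fstar f0) :=
    (hf.const_mul _).add (hf0.1.1.const_mul _)
  have hrel_risk := h.risk_relaxedPredictor hf hf0.1.1 α
  have hrel_unf : unfairness P X V S (relaxedPredictor α fstar f0) =
      ENNReal.ofReal α * unfairness P X V S fstar := by
    rw [h.unfairness_congr hrel_ae, hU]
    exact le_antisymm (h.unfairness_relaxedPredictor_le hf hprop hα.1)
      (h.le_unfairness_relaxedPredictor hf hprop hα)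
  have hrel_uniq : ∀ g : 𝒳 × Fin K → ℝ, Measurable g →
      unfairness P X V S g ≤ ENNReal.ofReal α * unfairness P X V S fstar →
      risk P X V S fstar g ≤ risk P X V S fstar (relaxedPredictor α fstar f0) →
      g =ᵐ[P.map fun ω => (X ω, S ω)] relaxedPredictor α fstar f0 := by
    intro g hg hgU hgR
    rw [hU] at hgU
    rw [hrel_risk, hrisk0] at hgR
    exact (h.ae_eq_relaxedPredictor hf hprop hα hg hgR
      ((h.dispersion_le_unfairness hg).trans hgU)).trans hrel_ae.symm
  refine ⟨hrisk0 ▸ hD, ⟨⟨hrel_meas, hrel_unf.le⟩, fun g hg hgU => ?_⟩, fun g hg =>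
    hrel_uniq g hg.1.1 hg.1.2 (hg.2 _ hrel_meas hrel_unf.le), hrel_risk, hrel_unf⟩
  rcases le_total (risk P X V S fstar (relaxedPredictor α fstar f0)) (risk P X V S fstar g)
    with hle | hle
  · exact hle
  · exact (h.risk_congr (hrel_uniq g hg hgU hle)).ge
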